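/- Let $K=\{0,\alpha,\beta,\gamma\}$ be the $2$-dimensional vector space over $\mathrm{GF}(2)$, with the bilinear form $\langle x,y\rangle_K=1$ if and only if $0\neq x\neq y\neq 0$. For a finite set $V$ equip $K^V$ with the form $\langle a,b\rangle=\sum_{v\in V}\langle a(v),b(v)\rangle_K$, and write $\mathrm{supp}(a)=\{v\in V: a(v)\ne 0\}$. For $X\subseteq V$ let $p_X:K^V\to K^X$ be the restriction map, and let $a[X]\in K^V$ agree with $a$ on $X$ and vanish off $X$. A vector is *complete* if its support is $V$. An *isotropic system* is a pair $S=(V,L)$ where $V$ is a finite set (of *vertices*) and $L\le K^V$ is a subspace with $\dim L=|V|$ and $\langle a,b\rangle=0$ for all $a,b\in L$. *Minors.* For $v\in V$ and $x\in K-\{0\}$, the elementary minor $S|_x^v$ is the isotropic system $(V-\{v\},\,\{p_{V-\{v\}}(a): a\in L,\ a(v)\in\{0,x\}\})$. *Connectivity.* For $X\subseteq V$ let $c_S(X)=|X|-\dim\{p_X(a):a\in L,\ \mathrm{supp}(a)\subseteq X\}$. A partition $(X,Y)$ of $V$ is a *$k$-separation* if $\min\{|X|,|Y|\}\ge k$ and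 $c_S(X)<k$; $S$ is *$k$-connected* if it has no $k'$-separation with $1\le k'<k$. A vertex $v$ is *non-essential* in $S$ if at least two of $S|_\alpha^v,S|_\beta^v,S|_\gamma^v$ are $3$-connected. *Cyclic systems.* A vector $a\in K^V$ is *Eulerian* for $S$ if it is complete and $a[X]\notin L$ for every nonempty $X\subseteq V$. Then for each $v\in V$ there is a unique $b_v\in L$ with $\langle b_v(v),a(v)\rangle_K=1$ and $\langle b_v(w),a(w)\rangle_K=0$ for all $w\neq v$; the *fundamental graph* of $S$ with respect to $a$ is the graph on $V$ in which distinct $v,w$ are adjacent if and only if $b_v(w)\ne0$. The system $S$ is *cyclic* if, for some Eulerian vector, its fundamental graph is a cycle graph of length at least $5$. *Tight paths.* Let $H(S)$ be the $3$-uniform hypergraph on $V$ whose edges are the supports of size $3$ of vectors in $L$. For $k\ge1$, a *tight path* of length $k$ in a $3$-uniform hypergraph $H$ is a hypergraph $P$ with $V(P)\subseteq V(H)$ and $E(P)\subseteq E(H)$ that admits an ordering $v_0,v_1,\dots,v_{k+1}$ of its (distinct) vertices such that $E(P)=\{\{v_{i-1},v_i,v_{i+1}\}:1\le i\le k\}$.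 It is *maximal* if there is no tight path $Q$ in $H$ with $E(P)\subsetneq E(Q)$. An *end* of $P$ is a vertex of $P$ incident with exactly one edge of $P$. **Proposition.** Let $S$ be a $3$-connected isotropic system with at least $5$ vertices that is not cyclic. Then for every maximal tight path $P$ in $H(S)$, at least two ends of $P$ are non-essential in $S$. -/

import Mathlib

/-- The 2-dimensional vector space `K = {0, α, β, γ}` over `GF(2)`;
`α = (1, 0)`, `β = (0, 1)`, `γ = (1, 1)`. -/
abbrev KK : Type := ZMod 2 × ZMod 2

/-- The bilinear form on `K` (see `kForm_eq_one_iff`). -/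
def kForm : LinearMap.BilinForm (ZMod 2) KK :=
  LinearMap.mk₂ (ZMod 2) (fun x y => x.1 * y.2 + x.2 * y.1)
    (by intros; simp only [Prod.fst_add, Prod.snd_add]; ring)
    (by intros; simp only [Prod.smul_fst, Prod.smul_snd, smul_eq_mul]; ring)
    (by intros; simp only [Prod.fst_add, Prod.snd_add]; ring)
    (by intros; simp only [Prod.smul_fst, Prod.smul_snd, smul_eq_mul]; ring)

theorem kForm_eq_one_iff (x y : KK) : kForm x y = 1 ↔ x ≠ 0 ∧ y ≠ 0 ∧ x ≠ y := by
  simp only [kForm, LinearMap.mk₂_apply]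
  revert x y
  decide

theorem kForm_eq_zero_iff {x : KK} (hx : x ≠ 0) (y : KK) : kForm x y = 0 ↔ y = 0 ∨ y = x := by
  simp only [kForm, LinearMap.mk₂_apply]
  revert x y
  decide

/-- The bilinear form `⟨a, b⟩ = ∑ v, ⟨a v, b v⟩` on `K^V`. -/
def vForm (V : Type*) [Fintype V] : LinearMap.BilinForm (ZMod 2) (V → KK) :=
  LinearMap.mk₂ (ZMod 2) (fun a b => ∑ v, kForm (a v) (b v))
    (by intros; simp [Finset.sum_add_distrib])
    (by intros; simp [Finset.mul_sum])
    (by intros; simp [Finset.sum_add_distrib])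
    (by intros; simp [Finset.mul_sum])

theorem vForm_apply {V : Type*} [Fintype V] (a b : V → KK) :
    vForm V a b = ∑ v, kForm (a v) (b v) := rfl

/-- An isotropic system `(V, L)`: a totally isotropic subspace `L` of `K^V` with `dim L = |V|`. -/
structure IsotropicSystem (V : Type*) [Fintype V] where
  L : Submodule (ZMod 2) (V → KK)
  isotropic : ∀ a ∈ L, ∀ b ∈ L, vForm V a b = 0
  finrank_eq : Module.finrank (ZMod 2) L = Fintype.card V

/-- `L|_x^v`, a subspace of `K^(V - {v})`. -/
def minorSpace {V : Type*} (L : Submodule (ZMod 2) (V → KK)) (v : V) (x : KK) :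
    Submodule (ZMod 2) ({w : V // w ≠ v} → KK) where
  carrier := {b | ∃ a ∈ L, (a v = 0 ∨ a v = x) ∧ b = fun w : {w : V // w ≠ v} => a w.1}
  add_mem' := by
    rintro _ _ ⟨a, ha, hav, rfl⟩ ⟨b, hb, hbv, rfl⟩
    refine ⟨a + b, L.add_mem ha hb, ?_, rfl⟩
    have key : ∀ y : KK, y + y = 0 := by decide
    rcases hav with h | h <;> rcases hbv with h' | h' <;> simp [h, h', key]
  zero_mem' := ⟨0, L.zero_mem, Or.inl rfl, rfl⟩
  smul_mem' := by
    rintro c _ ⟨a, ha, hav, rfl⟩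
    refine ⟨c • a, L.smul_mem c ha, ?_, rfl⟩
    have key : ∀ c : ZMod 2, c = 0 ∨ c = 1 := by decide
    rcases key c with rfl | rfl
    · exact Or.inl (by simp)
    · simpa using hav

/-- `L|_{⊆ X} = {p_X(a) : a ∈ L, supp(a) ⊆ X}`, a subspace of `K^X`. -/
def restrictSupported {V : Type*} (L : Submodule (ZMod 2) (V → KK)) (X : Set V) :
    Submodule (ZMod 2) (X → KK) where
  carrier := {b | ∃ a ∈ L, Function.support a ⊆ X ∧ b = fun w : X => a w.1}
  add_mem' := by
    rintro _ _ ⟨a, ha, hav, rfl⟩ ⟨b, hb, hbv, rfl⟩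
    exact ⟨a + b, L.add_mem ha hb,
      (Function.support_add a b).trans (Set.union_subset hav hbv), rfl⟩
  zero_mem' := ⟨0, L.zero_mem, by simp, rfl⟩
  smul_mem' := by
    rintro c _ ⟨a, ha, hav, rfl⟩
    exact ⟨c • a, L.smul_mem c ha, (Function.support_const_smul_subset c a).trans hav, rfl⟩

theorem kForm_comm (x y : KK) : kForm x y = kForm y x := by
  simp only [kForm, LinearMap.mk₂_apply]; ring

theorem vForm_comm {V : Type*} [Fintype V] (a b : V → KK) : vForm V a b = vForm V b a := by
  simp only [vForm_apply, kForm_comm]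

theorem vForm_single {V : Type*} [Fintype V] [DecidableEq V] (v : V) (x : KK) (a : V → KK) :
    vForm V (Pi.single v x) a = kForm x (a v) := by
  rw [vForm_apply, Finset.sum_eq_single v]
  · simp
  · intro w _ hw
    simp [Pi.single_eq_of_ne hw]
  · simp

theorem vForm_nondegenerate (V : Type*) [Fintype V] [DecidableEq V] :
    (vForm V).Nondegenerate := by
  have key : ∀ y : KK, (∀ x, kForm x y = 0) → y = 0 := by
    simp only [kForm, LinearMap.mk₂_apply]; decide
  have h : ∀ a, (∀ b, vForm V b a = 0) → a = 0 := fun a ha => by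
    funext v
    exact key _ fun x => by rw [← vForm_single v x a]; exact ha _
  exact ⟨fun a ha => h a fun b => by rw [vForm_comm]; exact ha b, fun a ha => h a ha⟩

theorem finrank_orthogonal_vForm {V : Type*} [Fintype V] [DecidableEq V]
    (L : Submodule (ZMod 2) (V → KK)) :
    Module.finrank (ZMod 2) ((vForm V).orthogonal L)
      = 2 * Fintype.card V - Module.finrank (ZMod 2) L := by
  rw [LinearMap.BilinForm.finrank_orthogonal (vForm_nondegenerate V)]
  simp [Module.finrank_pi_fintype, mul_comm]

theorem IsotropicSystem.orthogonal_eq {V : Type*} [Fintype V] [DecidableEq V]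
    (S : IsotropicSystem V) : (vForm V).orthogonal S.L = S.L := by
  symm
  apply Submodule.eq_of_le_of_finrank_eq
  · intro a ha
    rw [LinearMap.BilinForm.mem_orthogonal_iff]
    exact fun b hb => S.isotropic b hb a ha
  · rw [finrank_orthogonal_vForm, S.finrank_eq]; omega

theorem sum_kForm_split {V : Type*} [Fintype V] [DecidableEq V] (v : V) (a b : V → KK) :
    vForm V a b = kForm (a v) (b v)
      + vForm {w : V // w ≠ v} (fun w => a w.1) (fun w => b w.1) := by
  rw [vForm_apply, vForm_apply, Fintype.sum_eq_add_sum_subtype_ne _ v]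

theorem minorSpace_isotropic {V : Type*} [Fintype V] [DecidableEq V] (S : IsotropicSystem V)
    (v : V) {x : KK} (hx : x ≠ 0) :
    ∀ a ∈ minorSpace S.L v x, ∀ b ∈ minorSpace S.L v x, vForm {w : V // w ≠ v} a b = 0 := by
  rintro _ ⟨a, ha, hav, rfl⟩ _ ⟨b, hb, hbv, rfl⟩
  have h := S.isotropic a ha b hb
  rw [sum_kForm_split v] at h
  have h0 : kForm (a v) (b v) = 0 := by
    rcases hav with h | h
    · simp [h]
    · rw [h]; exact (kForm_eq_zero_iff hx _).2 hbv
  rwa [h0, zero_add] at h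

theorem minorSpace_finrank {V : Type*} [Fintype V] [DecidableEq V] (S : IsotropicSystem V)
    (v : V) {x : KK} (hx : x ≠ 0) :
    Module.finrank (ZMod 2) (minorSpace S.L v x) = Fintype.card {w : V // w ≠ v} := by
  have two : ∀ c : ZMod 2, c ≠ 0 → c = 1 := by decide
  have horth : (vForm {w : V // w ≠ v}).orthogonal (minorSpace S.L v x) = minorSpace S.L v x := by
    apply le_antisymm
    · intro b hb
      rw [LinearMap.BilinForm.mem_orthogonal_iff] at hb
      let b0 : V → KK := fun w => if h : w ≠ v then b ⟨w, h⟩ else 0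
      have hb0v : b0 v = 0 := by simp [b0]
      have hb0 : (fun w : {w : V // w ≠ v} => b0 w) = b := by
        funext w; simp [b0, w.2]
      have hz : ∀ a ∈ S.L, kForm x (a v) = 0 → vForm V b0 a = 0 := by
        intro a ha h
        rw [sum_kForm_split v, hb0v, hb0, vForm_comm]
        simpa using hb _ ⟨a, ha, (kForm_eq_zero_iff hx _).1 h, rfl⟩
      by_cases hall : ∀ a ∈ S.L, vForm V b0 a = 0
      · refine ⟨b0, ?_, Or.inl hb0v, hb0.symm⟩
        rw [← S.orthogonal_eq, LinearMap.BilinForm.mem_orthogonal_iff]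
        exact fun a ha => (vForm_comm a b0).trans (hall a ha)
      · push Not at hall
        obtain ⟨a₁, ha₁, h₁⟩ := hall
        have h₁x : kForm x (a₁ v) ≠ 0 := fun h => h₁ (hz a₁ ha₁ h)
        refine ⟨b0 + Pi.single v x, ?_, Or.inr (by simp [hb0v]), ?_⟩
        · rw [← S.orthogonal_eq, LinearMap.BilinForm.mem_orthogonal_iff]
          intro a ha
          refine (vForm_comm _ _).trans ?_
          rw [map_add, LinearMap.add_apply, vForm_single]
          by_cases h : kForm x (a v) = 0
          · rw [hz a ha h, h, add_zero]
          · have h2 := hz (a + a₁) (S.L.add_mem ha ha₁) (by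
              rw [Pi.add_apply, map_add, two _ h, two _ h₁x]; decide)
            rw [map_add, two _ h₁] at h2
            rw [two _ h, h2]
        · funext w
          simp [b0, w.2]
    · intro a ha
      rw [LinearMap.BilinForm.mem_orthogonal_iff]
      exact fun b hb => minorSpace_isotropic S v hx b hb a ha
  have h := finrank_orthogonal_vForm (minorSpace S.L v x)
  rw [horth] at h
  omega

namespace IsotropicSystem

/-- The elementary minor `S|_x^v = (V - {v}, L|_x^v)` for `x ∈ K - {0}`. -/
def minor {V : Type*} [Fintype V] [DecidableEq V] (S : IsotropicSystem V) (v : V) (x : KK)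
    (hx : x ≠ 0) : IsotropicSystem {w : V // w ≠ v} where
  L := minorSpace S.L v x
  isotropic := minorSpace_isotropic S v hx
  finrank_eq := minorSpace_finrank S v hx

/-- The connectivity function `c_S(X) = |X| - dim (L|_{⊆ X})`. -/
noncomputable def conn {V : Type*} [Fintype V] (S : IsotropicSystem V) (X : Set V) : ℤ :=
  (X.ncard : ℤ) - (Module.finrank (ZMod 2) (restrictSupported S.L X) : ℤ)

/-- The partition `(X, Y)` of the vertex set is a `k`-separation of `S`. -/
def IsSeparation {V : Type*} [Fintype V] (S : IsotropicSystem V) (k : ℕ) (X Y : Set V) : Prop :=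
  IsCompl X Y ∧ k ≤ min X.ncard Y.ncard ∧ S.conn X < (k : ℤ)

/-- `S` is `k`-connected: it has no `k'`-separation with `1 ≤ k' < k`. -/
def IsKConnected {V : Type*} [Fintype V] (S : IsotropicSystem V) (k : ℕ) : Prop :=
  ∀ k' : ℕ, 1 ≤ k' → k' < k → ∀ X Y : Set V, ¬ S.IsSeparation k' X Y

/-- `v` is non-essential: at least two of the three elementary minors `S|_x^v`, `x ∈ K - {0}`,
are 3-connected. -/
def NonEssential {V : Type*} [Fintype V] [DecidableEq V] (S : IsotropicSystem V) (v : V) : Prop :=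
  2 ≤ {x : KK | ∃ hx : x ≠ 0, (S.minor v x hx).IsKConnected 3}.ncard

/-- `a` is an Eulerian vector of `S`: it is complete, and `a[X] ∉ L` for every nonempty `X ⊆ V`. -/
def IsEulerian {V : Type*} [Fintype V] (S : IsotropicSystem V) (a : V → KK) : Prop :=
  (∀ v, a v ≠ 0) ∧ ∀ X : Set V, X.Nonempty → X.indicator a ∉ S.L

/-- `(b v)_{v ∈ V}` is the fundamental basis of `L` with respect to `a`. -/
def IsFundamentalBasis {V : Type*} [Fintype V] (S : IsotropicSystem V) (a : V → KK)
    (b : V → V → KK) : Prop :=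
  ∀ v, b v ∈ S.L ∧ kForm (b v v) (a v) = 1 ∧ ∀ w, w ≠ v → kForm (b v w) (a w) = 0

/-- `G` is a fundamental graph of `S`, that is, the fundamental graph of `S` with respect to
some Eulerian vector. -/
def IsFundamentalGraph {V : Type*} [Fintype V] (S : IsotropicSystem V) (G : SimpleGraph V) :
    Prop :=
  ∃ a : V → KK, S.IsEulerian a ∧ ∃ b : V → V → KK, S.IsFundamentalBasis a b ∧
    ∀ v w, G.Adj v w ↔ v ≠ w ∧ b v w ≠ 0

/-- `S` is cyclic: some fundamental graph of `S` is a cycle graph of length at least 5. -/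
def IsCyclic {V : Type*} [Fintype V] (S : IsotropicSystem V) : Prop :=
  ∃ G : SimpleGraph V, S.IsFundamentalGraph G ∧
    ∃ n : ℕ, 5 ≤ n ∧ Nonempty (G ≃g SimpleGraph.cycleGraph n)

/-- A triangle in `S`: a vector in `L` whose support has size 3. -/
def IsTriangle {V : Type*} [Fintype V] (S : IsotropicSystem V) (t : V → KK) : Prop :=
  t ∈ S.L ∧ (Function.support t).ncard = 3

/-- The triangle hypergraph `H(S)` on `V`. -/
def triangleHypergraph {V : Type*} [Fintype V] (S : IsotropicSystem V) : Hypergraph V where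
  vertexSet := Set.univ
  edgeSet := {e | ∃ t, S.IsTriangle t ∧ e = Function.support t}
  subset_vertexSet_of_mem_edgeSet' := fun _ _ => Set.subset_univ _

end IsotropicSystem

namespace Hypergraph

/-- `P` is a partial hypergraph of `H`. -/
def IsPartial {α : Type*} (P H : Hypergraph α) : Prop :=
  P.vertexSet ⊆ H.vertexSet ∧ P.edgeSet ⊆ H.edgeSet

/-- `P` is a tight path of length `k` in `H`: a partial hypergraph whose vertices can be ordered
as `v 0, …, v (k+1)` (without repetition) such that its edges are exactly the sets of three
consecutive vertices. -/
def IsTightPathOfLength {α : Type*} (H P : Hypergraph α) (k : ℕ) : Prop :=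
  1 ≤ k ∧ P.IsPartial H ∧ ∃ v : ℕ → α, Set.InjOn v (Set.Iic (k + 1)) ∧
    P.vertexSet = v '' Set.Iic (k + 1) ∧
    P.edgeSet = {e | ∃ i, 1 ≤ i ∧ i ≤ k ∧ e = {v (i - 1), v i, v (i + 1)}}

/-- `P` is a tight path in `H`. -/
def IsTightPath {α : Type*} (H P : Hypergraph α) : Prop :=
  ∃ k : ℕ, H.IsTightPathOfLength P k

/-- `P` is a maximal tight path in `H`. -/
def IsMaximalTightPath {α : Type*} (H P : Hypergraph α) : Prop :=
  H.IsTightPath P ∧ ¬ ∃ Q : Hypergraph α, H.IsTightPath Q ∧ P.edgeSet ⊂ Q.edgeSet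

/-- `v` is an end of the tight path `P`: a vertex incident with exactly one edge of `P`. -/
def IsEnd {α : Type*} (P : Hypergraph α) (v : α) : Prop :=
  v ∈ P.vertexSet ∧ {e | e ∈ P.edgeSet ∧ v ∈ e}.ncard = 1

end Hypergraph

/-! Two tools carry everything. One is orthogonality in `L`: vectors whose supports meet in a single
vertex agree there. The other is the connectivity function, which is symmetric and submodular.
Adding `v` to `X` does not raise `conn` if some vector supported on `insert v X` is nonzero at `v`,
and lowers it if two such vectors take different nonzero values there. In a 3-connected system on at
least five vertices, a 3-set with `conn` at most 2 is a triangle, and two triangles sharing exactly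
two vertices differ there.

If `v` is an essential vertex of a triangle `{v, u, w}`, some minor at `v` has a separation, which
splits the remaining vertices with `u` and `w` on opposite sides (`exists_isSplit`). Uncrossing the
splits at two essential vertices produces another triangle that shares two vertices with the first
(`exists_tri_of_two_essential`), in the manner of Tutte's triangle lemma for matroids. Hence a
maximal path that is a single triangle has at most one essential vertex.

On a longer path, an essential end `v 0` lies in a triangle with `v 1` or `v 2` and a vertex `z`
outside `v 0, …, v 3` (`exists_tri_of_essential`). If `z` is on the path, orthogonality gives a
contradiction (`Tri.false_of_tri`) or the path closes up and the system is cyclic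
(`IsPathSeq.isCyclic`, `IsPathSeq.isCyclic_of_tri_zero_two_four`). If `z` is off the path, either
orthogonality again fails or `z` extends the path, against maximality. -/

theorem kForm_eq_zero_iff_of_ne_zero {x y : KK} (hx : x ≠ 0) (hy : y ≠ 0) :
    kForm x y = 0 ↔ x = y := by
  rw [kForm_eq_zero_iff hx]
  exact ⟨fun h => (h.resolve_left hy).symm, fun h => Or.inr h.symm⟩

/-! ### The connectivity function -/

namespace IsotropicSystem

variable {V : Type*} [Fintype V] {S : IsotropicSystem V}

/-- The subspace of vectors in `L` whose support lies in `X`. -/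
def supported (S : IsotropicSystem V) (X : Set V) : Submodule (ZMod 2) (V → KK) where
  carrier := {a | a ∈ S.L ∧ Function.support a ⊆ X}
  add_mem' := fun ha hb => ⟨S.L.add_mem ha.1 hb.1,
    (Function.support_add _ _).trans (Set.union_subset ha.2 hb.2)⟩
  zero_mem' := ⟨S.L.zero_mem, by simp⟩
  smul_mem' := fun c a ha => ⟨S.L.smul_mem c ha.1,
    (Function.support_const_smul_subset c a).trans ha.2⟩

theorem mem_supported {X : Set V} {a : V → KK} :
    a ∈ S.supported X ↔ a ∈ S.L ∧ Function.support a ⊆ X := Iff.rfl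

theorem supported_mono {X Y : Set V} (h : X ⊆ Y) : S.supported X ≤ S.supported Y :=
  fun _ ha => ⟨ha.1, ha.2.trans h⟩

theorem apply_eq_zero {X : Set V} {a : V → KK} (ha : a ∈ S.supported X) {v : V} (hv : v ∉ X) :
    a v = 0 :=
  Function.notMem_support.1 fun h => hv (ha.2 h)

/-- Extension by zero inverts the restriction. Working inside the one space `V → KK` allows sums and
intersections for different `X`. -/
theorem finrank_restrictSupported (S : IsotropicSystem V) (X : Set V) :
    Module.finrank (ZMod 2) (restrictSupported S.L X)
      = Module.finrank (ZMod 2) (S.supported X) := by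
  let f : (V → KK) →ₗ[ZMod 2] (X → KK) := LinearMap.funLeft (ZMod 2) KK (Subtype.val)
  have hr : LinearMap.range (f.domRestrict (S.supported X)) = restrictSupported S.L X := by
    ext b
    constructor
    · rintro ⟨a, rfl⟩
      exact ⟨a.1, a.2.1, a.2.2, rfl⟩
    · rintro ⟨a, ha, hX, rfl⟩
      exact ⟨⟨a, ha, hX⟩, rfl⟩
  rw [← hr]
  apply LinearMap.finrank_range_of_inj
  intro a b hab
  ext1
  funext w
  by_cases hw : w ∈ X
  · exact congrFun hab ⟨w, hw⟩
  · rw [apply_eq_zero a.2 hw, apply_eq_zero b.2 hw]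

theorem conn_eq (S : IsotropicSystem V) (X : Set V) :
    S.conn X = (X.ncard : ℤ) - (Module.finrank (ZMod 2) (S.supported X) : ℤ) := by
  rw [conn, finrank_restrictSupported]

/-- Restriction of `L` to `X` has the vectors supported off `X` as kernel, and its image is
orthogonal to `restrictSupported S.L X`. Rank-nullity gives the inequality. -/
theorem conn_compl_le (S : IsotropicSystem V) (X : Set V) : S.conn Xᶜ ≤ S.conn X := by
  classical
  let f : S.L →ₗ[ZMod 2] (X → KK) :=
    (LinearMap.funLeft (ZMod 2) KK (Subtype.val)).domRestrict S.L
  have hker : Module.finrank (ZMod 2) (LinearMap.ker f)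
      = Module.finrank (ZMod 2) (S.supported Xᶜ) := by
    have hm : (LinearMap.ker f).map S.L.subtype = S.supported Xᶜ := by
      ext a
      constructor
      · rintro ⟨b, hb, rfl⟩
        refine ⟨b.2, fun w hw hwX => hw ?_⟩
        exact congrFun (LinearMap.mem_ker.1 hb) ⟨w, hwX⟩
      · intro ha
        refine ⟨⟨a, ha.1⟩, LinearMap.mem_ker.2 ?_, rfl⟩
        funext w
        exact apply_eq_zero ha fun h => h w.2
    rw [← hm]
    exact (LinearEquiv.finrank_eq
      (Submodule.equivMapOfInjective S.L.subtype S.L.injective_subtype _))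
  have hrange : LinearMap.range f ≤ (vForm X).orthogonal (restrictSupported S.L X) := by
    rintro _ ⟨a, rfl⟩
    rw [LinearMap.BilinForm.mem_orthogonal_iff]
    rintro _ ⟨b, hb, hbX, rfl⟩
    have h := S.isotropic b hb a a.2
    rw [vForm_apply] at h
    change vForm X _ _ = 0
    rw [vForm_apply, ← h]
    refine (Finset.sum_subtype X.toFinset (by simp) fun v => kForm (b v) (a.1 v)).symm.trans ?_
    refine Finset.sum_subset (Finset.subset_univ _) fun v _ hv => ?_
    rw [apply_eq_zero ⟨hb, hbX⟩ fun h => hv (Set.mem_toFinset.2 h), map_zero,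
      LinearMap.zero_apply]
  have h1 := Submodule.finrank_mono hrange
  rw [finrank_orthogonal_vForm, finrank_restrictSupported] at h1
  have h2 := LinearMap.finrank_range_add_finrank_ker f
  rw [S.finrank_eq, hker] at h2
  have h3 := Set.ncard_add_ncard_compl X
  rw [Nat.card_eq_fintype_card] at h3
  have h4 : Fintype.card X = X.ncard := by rw [← Nat.card_coe_set_eq, Nat.card_eq_fintype_card]
  have h5 : Module.finrank (ZMod 2) (S.supported X) ≤ 2 * X.ncard := by
    have := Submodule.finrank_le (restrictSupported S.L X)
    rw [finrank_restrictSupported] at this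
    simpa [Module.finrank_pi_fintype, mul_comm, h4] using this
  rw [conn_eq, conn_eq]
  omega

theorem conn_compl (S : IsotropicSystem V) (X : Set V) : S.conn Xᶜ = S.conn X :=
  le_antisymm (S.conn_compl_le X) (by simpa using S.conn_compl_le Xᶜ)

/-- The supported subspaces of `X` and `Y` intersect in that of `X ∩ Y`, and their sum lies in that
of `X ∪ Y`. -/
theorem conn_inter_add_conn_union_le (S : IsotropicSystem V) (X Y : Set V) :
    S.conn (X ∩ Y) + S.conn (X ∪ Y) ≤ S.conn X + S.conn Y := by
  have h1 := Submodule.finrank_sup_add_finrank_inf_eq (S.supported X) (S.supported Y)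
  have h2 : S.supported X ⊓ S.supported Y = S.supported (X ∩ Y) := by
    ext a
    simp only [Submodule.mem_inf, mem_supported, Set.subset_inter_iff]
    tauto
  have h3 := Submodule.finrank_mono (sup_le (supported_mono (S := S) Set.subset_union_left)
    (supported_mono (S := S) (Set.subset_union_right (s := X) (t := Y))))
  have h4 := Set.ncard_union_add_ncard_inter X Y
  rw [h2] at h1
  simp only [conn_eq]
  omega

theorem conn_le_ncard (S : IsotropicSystem V) (X : Set V) : S.conn X ≤ X.ncard := by
  rw [conn_eq]; omega

theorem conn_insert_le {X : Set V} {v : V} (hv : v ∉ X) {a : V → KK}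
    (ha : a ∈ S.supported (insert v X)) (hav : a v ≠ 0) : S.conn (insert v X) ≤ S.conn X := by
  have h : S.supported X < S.supported (insert v X) :=
    lt_of_le_of_ne (supported_mono (Set.subset_insert v X)) fun h => by
      rw [← h] at ha
      exact hav (apply_eq_zero ha hv)
  have := Submodule.finrank_lt_finrank_of_lt h
  rw [conn_eq, conn_eq, Set.ncard_insert_of_notMem hv]
  omega

/-- The values at `v` of vectors supported on `insert v X` fill all of `KK`, so the dimension grows
by two while the size grows by one. -/
theorem conn_insert_lt {X : Set V} {v : V} (hv : v ∉ X) {a b : V → KK}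
    (ha : a ∈ S.supported (insert v X)) (hb : b ∈ S.supported (insert v X))
    (hab : kForm (a v) (b v) = 1) : S.conn (insert v X) < S.conn X := by
  obtain ⟨hav, hbv, -⟩ := (kForm_eq_one_iff _ _).1 hab
  -- `M` lies strictly between the two supported subspaces: it contains `a` but not `b`.
  let M : Submodule (ZMod 2) (V → KK) := S.supported (insert v X) ⊓
    LinearMap.ker ((kForm (a v)).comp (LinearMap.proj v))
  have hM : ∀ e, e ∈ M ↔ e ∈ S.supported (insert v X) ∧ kForm (a v) (e v) = 0 := fun e => by
    simp [M]
  have h1 : S.supported X < M := by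
    refine lt_of_le_of_ne (fun e he => (hM e).2
      ⟨supported_mono (Set.subset_insert v X) he, by rw [apply_eq_zero he hv, map_zero]⟩)
      fun h => hav (apply_eq_zero (X := X) (S := S) ?_ hv)
    rw [h, hM]
    exact ⟨ha, (kForm_eq_zero_iff hav _).2 (Or.inr rfl)⟩
  have h2 : M < S.supported (insert v X) := by
    refine lt_of_le_of_ne inf_le_left fun h => ?_
    rw [← h, hM, hab] at hb
    exact one_ne_zero hb.2
  have := Submodule.finrank_lt_finrank_of_lt h1
  have := Submodule.finrank_lt_finrank_of_lt h2
  rw [conn_eq, conn_eq, Set.ncard_insert_of_notMem hv]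
  omega

theorem exists_apply_ne_zero_of_conn_insert_le {X : Set V} {v : V} (hv : v ∉ X)
    (h : S.conn (insert v X) ≤ S.conn X) : ∃ e ∈ S.supported (insert v X), e v ≠ 0 := by
  by_contra! hall
  have : S.supported (insert v X) ≤ S.supported X := fun e he =>
    ⟨he.1, fun w hw => (he.2 hw).resolve_left fun hwv => hw (hwv ▸ hall e he)⟩
  have := Submodule.finrank_mono this
  rw [conn_eq, conn_eq, Set.ncard_insert_of_notMem hv] at h
  omega

theorem exists_ne_zero_of_conn_lt {X : Set V} (h : S.conn X < X.ncard) :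
    ∃ e ∈ S.supported X, e ≠ 0 := by
  have : S.supported X ≠ ⊥ := fun h0 => by
    rw [conn_eq, h0, finrank_bot] at h
    simp at h
  exact Submodule.exists_mem_ne_zero_of_ne_bot this

/-! ### Orthogonality and triangles -/

/-- Vectors of `L` whose supports meet only inside `s` are orthogonal over `s`. -/
theorem sum_kForm_eq_zero {X Y : Set V} {a b : V → KK} (ha : a ∈ S.supported X)
    (hb : b ∈ S.supported Y) (s : Finset V) (h : X ∩ Y ⊆ s) :
    ∑ v ∈ s, kForm (a v) (b v) = 0 := by
  rw [← S.isotropic a ha.1 b hb.1, vForm_apply]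
  refine Finset.sum_subset (Finset.subset_univ s) fun v _ hv => ?_
  by_cases hX : v ∈ X
  · rw [apply_eq_zero hb fun hY => hv (Finset.mem_coe.1 (h ⟨hX, hY⟩)), map_zero]
  · rw [apply_eq_zero ha hX, map_zero, LinearMap.zero_apply]

theorem kForm_eq_zero_of_inter_subset {X Y : Set V} {a b : V → KK} (ha : a ∈ S.supported X)
    (hb : b ∈ S.supported Y) {p : V} (h : X ∩ Y ⊆ {p}) : kForm (a p) (b p) = 0 := by
  have := sum_kForm_eq_zero ha hb {p} (by simpa using h)
  simpa using this

theorem kForm_eq_of_inter_subset {X Y : Set V} {a b : V → KK} (ha : a ∈ S.supported X)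
    (hb : b ∈ S.supported Y) {p q : V} (hpq : p ≠ q) (h : X ∩ Y ⊆ {p, q}) :
    kForm (a p) (b p) = kForm (a q) (b q) := by
  classical
  have := sum_kForm_eq_zero ha hb {p, q} (by simpa using h)
  rw [Finset.sum_pair hpq] at this
  generalize kForm (a p) (b p) = x at *
  generalize kForm (a q) (b q) = y at *
  revert x y
  decide

theorem two_le_conn (h3 : S.IsKConnected 3) {X : Set V} (hX : 2 ≤ X.ncard)
    (hXc : 2 ≤ Xᶜ.ncard) : 2 ≤ S.conn X := by
  by_contra! h
  exact h3 2 (by norm_num) (by norm_num) X Xᶜ ⟨isCompl_compl, le_min hX hXc, h⟩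

theorem ncard_compl_add (X : Set V) : X.ncard + Xᶜ.ncard = Fintype.card V := by
  rw [Set.ncard_add_ncard_compl, Nat.card_eq_fintype_card]

theorem ncard_insert_pair {p q r : V} (hpq : p ≠ q) (hpr : p ≠ r) (hqr : q ≠ r) :
    ({p, q, r} : Set V).ncard = 3 := by
  rw [Set.ncard_insert_of_notMem (by simp [hpq, hpr]), Set.ncard_pair hqr]

/-- A pair has `conn` at least 2, its own size, so its supported subspace is zero. -/
theorem eq_zero_of_support_subset_pair (h3 : S.IsKConnected 3) (hV : 5 ≤ Fintype.card V)
    {p q : V} {a : V → KK} (ha : a ∈ S.supported {p, q}) : a = 0 := by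
  by_contra hne
  have key : ∀ r s : V, r ≠ s → a ∈ S.supported {r, s} → False := by
    intro r s hrs ha
    have hn := Set.ncard_pair hrs
    have h := two_le_conn h3 (X := {r, s}) (by omega) (by have := ncard_compl_add {r, s}; omega)
    have h1 : Module.finrank (ZMod 2) (S.supported {r, s}) ≠ 0 := fun h0 =>
      hne (Submodule.mem_bot (ZMod 2) |>.1 (Submodule.finrank_eq_zero.1 h0 ▸ ha))
    rw [conn_eq] at h
    omega
  by_cases hpq : p = q
  · obtain ⟨r, hr⟩ := Fintype.exists_ne_of_one_lt_card (by omega : 1 < Fintype.card V) p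
    refine key p r hr.symm (supported_mono ?_ ha)
    simp [hpq]
  · exact key p q hpq ha

/-- `{p, q, r}` is a 3-element set that is the support of a vector of `L`. -/
def Tri (S : IsotropicSystem V) (p q r : V) : Prop :=
  p ≠ q ∧ p ≠ r ∧ q ≠ r ∧ ∃ t ∈ S.L, Function.support t = {p, q, r}

theorem Tri.rotate {p q r : V} (h : S.Tri p q r) : S.Tri q r p := by
  obtain ⟨h1, h2, h3, t, ht, hs⟩ := h
  refine ⟨h3, h1.symm, h2.symm, t, ht, hs.trans ?_⟩
  ext; simp; tauto

theorem Tri.swap {p q r : V} (h : S.Tri p q r) : S.Tri q p r := by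
  obtain ⟨h1, h2, h3, t, ht, hs⟩ := h
  exact ⟨h1.symm, h3, h2, t, ht, hs.trans (Set.insert_comm _ _ _)⟩

theorem Tri.reverse {p q r : V} (h : S.Tri p q r) : S.Tri r q p := h.rotate.swap

/-- Since `conn` is below 3, a nonzero vector lives on the set; it cannot vanish at any of the three
vertices, as its support would then fit in a pair. -/
theorem tri_of_conn_le (h3 : S.IsKConnected 3) (hV : 5 ≤ Fintype.card V) {p q r : V}
    (hpq : p ≠ q) (hpr : p ≠ r) (hqr : q ≠ r) (h : S.conn {p, q, r} ≤ 2) : S.Tri p q r := by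
  obtain ⟨e, he, hne⟩ := exists_ne_zero_of_conn_lt (S := S) (X := {p, q, r})
    (by rw [ncard_insert_pair hpq hpr hqr]; norm_num; omega)
  refine ⟨hpq, hpr, hqr, e, he.1, he.2.antisymm ?_⟩
  have key : ∀ s x y : V, ({p, q, r} : Set V) ⊆ {s, x, y} → s ∈ Function.support e := by
    intro s x y hs h0
    refine hne (eq_zero_of_support_subset_pair h3 hV (p := x) (q := y) ⟨he.1, fun w hw => ?_⟩)
    refine (hs (he.2 hw)).resolve_left fun hws => hw ?_
    rw [hws, h0]
  rintro s (rfl | rfl | rfl)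
  · exact key s q r le_rfl
  · exact key s p r (Set.insert_comm _ _ _).le
  · exact key s p q (by intro w; simp; tauto)

/-- Two triangles sharing exactly two vertices differ on them. -/
theorem kForm_eq_one_of_triangles (h3 : S.IsKConnected 3) (hV : 5 ≤ Fintype.card V)
    {p q r s : V} (hpq : p ≠ q) (hr : r ≠ p ∧ r ≠ q) (hrs : r ≠ s) {a b : V → KK}
    (ha : a ∈ S.L) (hb : b ∈ S.L)
    (has : Function.support a = {p, q, r}) (hbs : Function.support b = {p, q, s}) :
    kForm (a p) (b p) = 1 := by
  have two : ∀ c : ZMod 2, c ≠ 0 → c = 1 := by decide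
  have self : ∀ x : KK, x + x = 0 := by decide
  have hane : ∀ w ∈ ({p, q, r} : Set V), a w ≠ 0 := fun w hw => by
    rw [← Function.mem_support, has]; exact hw
  have hbne : ∀ w ∈ ({p, q, s} : Set V), b w ≠ 0 := fun w hw => by
    rw [← Function.mem_support, hbs]; exact hw
  -- If the vectors agree at `p`, orthogonality makes them agree at `q`, and then their sum is
  -- supported on `{r, s}`, hence zero.
  refine two _ fun h0 => ?_
  have h0' := h0
  rw [kForm_eq_of_inter_subset ⟨ha, has.le⟩ ⟨hb, hbs.le⟩ hpq] at h0'
  · rw [kForm_eq_zero_iff_of_ne_zero (hane p (by simp)) (hbne p (by simp))] at h0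
    rw [kForm_eq_zero_iff_of_ne_zero (hane q (by simp)) (hbne q (by simp))] at h0'
    have hz : a + b = 0 := by
      refine eq_zero_of_support_subset_pair h3 hV (p := r) (q := s)
        ⟨S.L.add_mem ha hb, fun w hw => ?_⟩
      have hw' : w ∈ ({p, q, r} ∪ {p, q, s} : Set V) := by
        rw [← has, ← hbs]
        exact Function.support_add a b hw
      have hp : w ≠ p := fun h => hw (by rw [h, Pi.add_apply, h0, self])
      have hq : w ≠ q := fun h => hw (by rw [h, Pi.add_apply, h0', self])
      simp only [Set.mem_union, Set.mem_insert_iff, Set.mem_singleton_iff] at hw' ⊢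
      tauto
    have hbr : b r = 0 := by
      rw [← Function.notMem_support, hbs]
      simp [hr, hrs]
    have := congrFun hz r
    rw [Pi.add_apply, hbr, add_zero] at this
    exact hane r (by simp) this
  · rintro w ⟨hw1, hw2⟩
    simp only [Set.mem_insert_iff, Set.mem_singleton_iff] at hw1 hw2 ⊢
    rcases hw1 with h | h | h
    · exact Or.inl h
    · exact Or.inr h
    · rcases hw2 with h' | h' | h'
      · exact Or.inl h'
      · exact Or.inr h'
      · exact absurd (h.symm.trans h') hrs

theorem eq_of_inter_subset {X Y : Set V} {a b : V → KK} (ha : a ∈ S.supported X)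
    (hb : b ∈ S.supported Y) {p : V} (h : X ∩ Y ⊆ {p}) (hap : a p ≠ 0) (hbp : b p ≠ 0) :
    a p = b p :=
  (kForm_eq_zero_iff_of_ne_zero hap hbp).1 (kForm_eq_zero_of_inter_subset ha hb h)

/-! ### Separations of elementary minors -/

section Minor

variable [DecidableEq V]

/-- Vectors of the minor supported on `X` lift to `N`, so `N` has dimension at least `X.ncard - 1`.
This bounds `conn (insert v A)`. By 3-connectivity the vectors supported on `A` have dimension at
most `X.ncard - 2`, so some vector of `N` has value `x` at `v`. -/
theorem minor_separation_aux (h3 : S.IsKConnected 3) {v : V} {x : KK} (hx : x ≠ 0)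
    {X : Set {w : V // w ≠ v}} (hX : (S.minor v x hx).conn X < 2) (h2 : 2 ≤ X.ncard)
    (h2c : 2 ≤ Xᶜ.ncard) :
    S.conn (insert v (Subtype.val '' X)) ≤ 2 ∧
      ∃ a ∈ S.supported (insert v (Subtype.val '' X)), a v = x := by
  set A : Set V := Subtype.val '' X with hA
  have hvA : v ∉ A := by rintro ⟨w, -, hw⟩; exact w.2 hw
  have hAX : A.ncard = X.ncard := Set.ncard_image_of_injective _ Subtype.val_injective
  have hAc : 2 ≤ Aᶜ.ncard := by
    have : Subtype.val '' Xᶜ ⊆ Aᶜ := by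
      rintro _ ⟨w, hw, rfl⟩ ⟨w', hw', h⟩
      exact hw (Subtype.val_injective h ▸ hw')
    have := Set.ncard_le_ncard this
    rw [Set.ncard_image_of_injective _ Subtype.val_injective] at this
    omega
  have hcA := two_le_conn h3 (hAX ▸ h2) hAc
  let N : Submodule (ZMod 2) (V → KK) := S.supported (insert v A) ⊓
    LinearMap.ker ((kForm x).comp (LinearMap.proj v))
  have hN : ∀ e, e ∈ N ↔ e ∈ S.supported (insert v A) ∧ (e v = 0 ∨ e v = x) := fun e => by
    simp [N, kForm_eq_zero_iff hx]
  let f : (V → KK) →ₗ[ZMod 2] ({w : V // w ≠ v} → KK) :=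
    LinearMap.funLeft (ZMod 2) KK (Subtype.val)
  have hle : (S.minor v x hx).supported X ≤ N.map f := by
    rintro b ⟨⟨a, ha, hav, rfl⟩, hb⟩
    refine ⟨a, (hN a).2 ⟨⟨ha, fun w hw => ?_⟩, hav⟩, rfl⟩
    by_cases hwv : w = v
    · exact Or.inl hwv
    · exact Or.inr ⟨⟨w, hwv⟩, hb hw, rfl⟩
  have h1 := (Submodule.finrank_mono hle).trans (Submodule.finrank_map_le f N)
  have h4 : Module.finrank (ZMod 2) N ≤ Module.finrank (ZMod 2) (S.supported (insert v A)) :=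
    Submodule.finrank_mono inf_le_left
  rw [conn_eq] at hX hcA
  refine ⟨?_, ?_⟩
  · rw [conn_eq, Set.ncard_insert_of_notMem hvA]
    omega
  · by_contra! hall
    have : N ≤ S.supported A := fun e he => by
      obtain ⟨he, h0⟩ := (hN e).1 he
      refine ⟨he.1, fun w hw => (he.2 hw).resolve_left fun hwv => hw ?_⟩
      rw [hwv]
      exact h0.resolve_right (hall e he)
    have := Submodule.finrank_mono this
    omega

theorem one_le_conn_minor (h3 : S.IsKConnected 3) (hV : 5 ≤ Fintype.card V) {v : V} {x : KK}
    (hx : x ≠ 0) (w : {w : V // w ≠ v}) : 1 ≤ (S.minor v x hx).conn {w} := by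
  by_contra! h
  obtain ⟨b, ⟨⟨a, ha, hav, rfl⟩, hb⟩, hne⟩ :=
    exists_ne_zero_of_conn_lt (S := S.minor v x hx) (X := {w}) (by simpa using h)
  refine hne ?_
  have : a = 0 := eq_zero_of_support_subset_pair h3 hV (p := v) (q := w.1) ⟨ha, fun u hu => by
    by_cases huv : u = v
    · exact Or.inl huv
    · exact Or.inr (congrArg Subtype.val (hb (show (⟨u, huv⟩ : {w : V // w ≠ v}) ∈ _ from hu)))⟩
  subst this
  rfl

/-- The structure of a separation of an elementary minor of a 3-connected system. -/
theorem exists_of_minor_not_connected (h3 : S.IsKConnected 3) (hV : 5 ≤ Fintype.card V) {v : V}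
    {x : KK} (hx : x ≠ 0) (h : ¬ (S.minor v x hx).IsKConnected 3) :
    ∃ A B : Set V, Disjoint A B ∧ v ∉ A ∧ v ∉ B ∧ A ∪ B = {v}ᶜ ∧ 2 ≤ A.ncard ∧ 2 ≤ B.ncard ∧
      S.conn (insert v A) ≤ 2 ∧ S.conn (insert v B) ≤ 2 ∧
      (∃ a ∈ S.supported (insert v A), a v = x) ∧ ∃ b ∈ S.supported (insert v B), b v = x := by
  unfold IsKConnected at h
  push Not at h
  obtain ⟨k, hk1, hk3, X, Y, hXY, hk, hc⟩ := h
  obtain rfl := hXY.compl_eq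
  obtain ⟨hkX, hkY⟩ := le_min_iff.1 hk
  have hc2 : (S.minor v x hx).conn X < 2 := by omega
  have hc2' : (S.minor v x hx).conn Xᶜ < 2 := by rwa [conn_compl]
  -- A 1-separation with two large sides also serves as a 2-separation; one with a singleton side is
  -- excluded by `one_le_conn_minor`.
  have hk2 : 2 ≤ X.ncard ∧ 2 ≤ Xᶜ.ncard := by
    by_contra hcon
    have hk1' : k = 1 := by omega
    subst hk1'
    have key : ∀ Z : Set {w : V // w ≠ v}, Z.ncard = 1 → 1 ≤ (S.minor v x hx).conn Z := by
      intro Z hZ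
      obtain ⟨w, rfl⟩ := Set.ncard_eq_one.1 hZ
      exact one_le_conn_minor h3 hV hx w
    rcases (by omega : X.ncard = 1 ∨ Xᶜ.ncard = 1) with h | h
    · have := key _ h
      omega
    · have := key _ h
      rw [conn_compl] at this
      omega
  obtain ⟨h1, h2⟩ := minor_separation_aux h3 hx hc2 hk2.1 hk2.2
  obtain ⟨h1', h2'⟩ := minor_separation_aux h3 hx hc2' hk2.2 (by rw [compl_compl]; exact hk2.1)
  refine ⟨Subtype.val '' X, Subtype.val '' Xᶜ, ?_, ?_, ?_, ?_, ?_, ?_, h1, h1', h2, h2'⟩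
  · exact (Set.disjoint_image_iff Subtype.val_injective).2 disjoint_compl_right
  · rintro ⟨w, -, hw⟩; exact w.2 hw
  · rintro ⟨w, -, hw⟩; exact w.2 hw
  · rw [← Set.image_union, Set.union_compl_self, Set.image_univ]
    exact Subtype.range_coe
  · rw [Set.ncard_image_of_injective _ Subtype.val_injective]; exact hk2.1
  · rw [Set.ncard_image_of_injective _ Subtype.val_injective]; exact hk2.2

/-- There are two nonzero values other than `y`; if both minors were 3-connected, `v` would be
non-essential. -/
theorem exists_minor_not_connected {v : V} (h : ¬ S.NonEssential v) {y : KK} :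
    ∃ x, ∃ hx : x ≠ 0, x ≠ y ∧ ¬ (S.minor v x hx).IsKConnected 3 := by
  by_contra! hall
  apply h
  have key : ∀ y : KK, ∃ x₁ x₂ : KK, x₁ ≠ x₂ ∧ x₁ ≠ 0 ∧ x₂ ≠ 0 ∧ x₁ ≠ y ∧ x₂ ≠ y := by decide
  obtain ⟨x₁, x₂, hne, h1, h2, h1y, h2y⟩ := key y
  refine (Set.ncard_pair hne).ge.trans (Set.ncard_le_ncard ?_ (Set.toFinite _))
  rintro x (rfl | rfl)
  · exact ⟨h1, hall _ h1 h1y⟩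
  · exact ⟨h2, hall _ h2 h2y⟩

/-- `(A, B)` separates `u` from `w` in an elementary minor at `v` other than `S|_{t(v)}^v`. -/
structure IsSplit (S : IsotropicSystem V) (t : V → KK) (v u w : V) (A B : Set V) : Prop where
  disj : Disjoint A B
  notMem_left : v ∉ A
  notMem_right : v ∉ B
  union_eq : A ∪ B = {v}ᶜ
  ncard_left : 2 ≤ A.ncard
  ncard_right : 2 ≤ B.ncard
  mem_left : u ∈ A
  mem_right : w ∈ B
  conn_insert_left : S.conn (insert v A) ≤ 2
  conn_insert_right : S.conn (insert v B) ≤ 2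
  exists_left : ∃ a ∈ S.supported (insert v A), kForm (a v) (t v) = 1
  exists_right : ∃ b ∈ S.supported (insert v B), kForm (b v) (t v) = 1

/-- If `v` is an essential vertex of the triangle `{v, u, w}`, some elementary minor at `v` has
a separation with `u` and `w` on different sides. -/
theorem exists_isSplit (h3 : S.IsKConnected 3) (hV : 5 ≤ Fintype.card V) {v u w : V}
    {t : V → KK} (ht : t ∈ S.L) (hs : Function.support t = {v, u, w}) (hvu : v ≠ u)
    (hvw : v ≠ w) (hv : ¬ S.NonEssential v) : ∃ A B : Set V, S.IsSplit t v u w A B := by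
  have htv : t v ≠ 0 := by rw [← Function.mem_support, hs]; simp
  obtain ⟨x, hx, hxt, hm⟩ := exists_minor_not_connected hv (y := t v)
  obtain ⟨A, B, hAB, hvA, hvB, hU, hA, hB, hcA, hcB, ⟨a, ha, rfl⟩, b, hb, hbv⟩ :=
    exists_of_minor_not_connected h3 hV hx hm
  have hk : kForm (a v) (t v) = 1 := (kForm_eq_one_iff _ _).2 ⟨hx, htv, hxt⟩
  have hkb : kForm (b v) (t v) = 1 := by rw [hbv, hk]
  -- If `u` and `w` both lay in `X`, the vector `c` from the other side would meet the triangle only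
  -- in `v` and differ from it there.
  have key : ∀ X Y : Set V, Disjoint X Y → ∀ c ∈ S.supported (insert v Y),
      kForm (c v) (t v) = 1 → ¬ (u ∈ X ∧ w ∈ X) := by
    rintro X Y hd c hc hcv ⟨hu, hw⟩
    have := kForm_eq_zero_of_inter_subset (p := v) hc ⟨ht, hs.le⟩ (by
      rintro z ⟨hz | hz, hz' | hz' | hz'⟩
      · exact hz
      · exact hz
      · exact hz
      · exact hz'
      · subst hz'
        exact absurd hz (Set.disjoint_left.1 hd hu)
      · subst hz'
        exact absurd hz (Set.disjoint_left.1 hd hw))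
    rw [hcv] at this
    exact one_ne_zero this
  have hu : u ∈ A ∪ B := by rw [hU]; exact hvu.symm
  have hw : w ∈ A ∪ B := by rw [hU]; exact hvw.symm
  have kA := key A B hAB b hb hkb
  have kB := key B A hAB.symm a ha hk
  by_cases huA : u ∈ A
  · exact ⟨A, B, hAB, hvA, hvB, hU, hA, hB, huA, hw.resolve_left fun h => kA ⟨huA, h⟩, hcA, hcB,
      ⟨a, ha, hk⟩, b, hb, hkb⟩
  · have huB := hu.resolve_left huA
    exact ⟨B, A, hAB.symm, hvB, hvA, (Set.union_comm _ _).trans hU, hB, hA, huB,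
      hw.resolve_right fun h => kB ⟨huB, h⟩, hcB, hcA, ⟨b, hb, hkb⟩, a, ha, hk⟩

end Minor

/-! ### Uncrossing the splits at two vertices of a triangle -/

theorem conn_inter_le_two (h3 : S.IsKConnected 3) {X Y : Set V} (hX : S.conn X ≤ 2)
    (hY : S.conn Y ≤ 2) (h : 2 ≤ (X ∪ Y).ncard) (hc : 2 ≤ (X ∪ Y)ᶜ.ncard) :
    S.conn (X ∩ Y) ≤ 2 := by
  have h1 := two_le_conn h3 h hc
  have h2 := S.conn_inter_add_conn_union_le X Y
  omega

theorem two_le_ncard {X : Set V} {x y : V} (hx : x ∈ X) (hy : y ∈ X) (hxy : x ≠ y) :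
    2 ≤ X.ncard :=
  (Set.one_lt_ncard (Set.toFinite X)).2 ⟨x, hx, y, hy, hxy⟩

/-- Two vectors of `L` with different values at `v` that meet `X ∪ {v}` only in `v` force `X` to
be small. -/
theorem ncard_le_one_of_kForm_eq_one (h3 : S.IsKConnected 3) {X F G : Set V} {v : V}
    (hv : v ∉ X) (hXc : 2 ≤ Xᶜ.ncard) (h : S.conn (insert v X) ≤ 2) {f g : V → KK}
    (hf : f ∈ S.supported F) (hg : g ∈ S.supported G) (hF : Disjoint F X) (hG : Disjoint G X)
    (hfg : kForm (f v) (g v) = 1) : X.ncard ≤ 1 := by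
  by_contra hX
  -- Here `conn X` is at least 2, so adding `v` does not raise it. The resulting `e` meets both `f`
  -- and `g` in `v` alone, so it would have to equal two different values there.
  obtain ⟨e, he, hev⟩ := exists_apply_ne_zero_of_conn_insert_le hv
    (h.trans (two_le_conn h3 (by omega) hXc))
  obtain ⟨hfv, hgv, hne⟩ := (kForm_eq_one_iff _ _).1 hfg
  have key : ∀ Z : Set V, Disjoint Z X → insert v X ∩ Z ⊆ {v} := by
    rintro Z hZ w ⟨rfl | hw, hwZ⟩
    · rfl
    · exact absurd hw (Set.disjoint_left.1 hZ hwZ)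
  exact hne ((eq_of_inter_subset he hf (key F hF) hev hfv).symm.trans
    (eq_of_inter_subset he hg (key G hG) hev hgv))

theorem ncard_le_two_of_subset_insert {A s : Set V} {p : V} (hs : s.ncard ≤ 1)
    (hA : A ⊆ insert p s) : A.ncard ≤ 2 :=
  (Set.ncard_le_ncard hA).trans ((Set.ncard_insert_le p s).trans (by omega))

namespace IsSplit

variable {t : V → KK} {v u w : V} {A B C D : Set V}

theorem symm (h : S.IsSplit t v u w A B) : S.IsSplit t v w u B A where
  disj := h.disj.symm
  notMem_left := h.notMem_right
  notMem_right := h.notMem_left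
  union_eq := (Set.union_comm _ _).trans h.union_eq
  ncard_left := h.ncard_right
  ncard_right := h.ncard_left
  mem_left := h.mem_right
  mem_right := h.mem_left
  conn_insert_left := h.conn_insert_right
  conn_insert_right := h.conn_insert_left
  exists_left := h.exists_right
  exists_right := h.exists_left

theorem notMem_of_mem_left (h : S.IsSplit t v u w A B) {z : V} (hz : z ∈ A) : z ∉ B :=
  Set.disjoint_left.1 h.disj hz

theorem notMem_of_mem_right (h : S.IsSplit t v u w A B) {z : V} (hz : z ∈ B) : z ∉ A :=
  Set.disjoint_right.1 h.disj hz

theorem ne_of_mem_left (h : S.IsSplit t v u w A B) {z : V} (hz : z ∈ A) : z ≠ v :=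
  fun hzv => h.notMem_left (hzv ▸ hz)

theorem ne_of_mem_right (h : S.IsSplit t v u w A B) {z : V} (hz : z ∈ B) : z ≠ v :=
  fun hzv => h.notMem_right (hzv ▸ hz)

theorem mem_or_mem (h : S.IsSplit t v u w A B) {z : V} (hz : z ≠ v) : z ∈ A ∨ z ∈ B := by
  have : z ∈ A ∪ B := by rw [h.union_eq]; exact hz
  exact this

theorem compl_left (h : S.IsSplit t v u w A B) : Aᶜ = insert v B := by
  ext z
  constructor
  · intro hz
    by_cases hzv : z = v
    · exact Or.inl hzv
    · exact Or.inr ((h.mem_or_mem hzv).resolve_left hz)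
  · rintro (rfl | hz)
    · exact h.notMem_left
    · exact h.notMem_of_mem_right hz

theorem conn_left (h : S.IsSplit t v u w A B) : S.conn A ≤ 2 := by
  rw [← conn_compl, h.compl_left]
  exact h.conn_insert_right

theorem exists_tri (h : S.IsSplit t v u w A B) (h3 : S.IsKConnected 3)
    (hV : 5 ≤ Fintype.card V) (hA : A.ncard ≤ 2) : ∃ r ∈ A, S.Tri v u r := by
  have h2 := h.ncard_left
  obtain ⟨r, hrA, hru⟩ := Set.exists_ne_of_one_lt_ncard (by omega : 1 < A.ncard) u
  have hAe : ({u, r} : Set V) = A := Set.eq_of_subset_of_ncard_le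
    (Set.insert_subset h.mem_left (Set.singleton_subset_iff.2 hrA))
    (by rw [Set.ncard_pair hru.symm]; exact hA)
  refine ⟨r, hrA, tri_of_conn_le h3 hV (h.ne_of_mem_left h.mem_left).symm
    (h.ne_of_mem_left hrA).symm hru.symm ?_⟩
  have := h.conn_insert_left
  rwa [← hAe] at this

/-- With `v`, the vertex of `B ∩ C` leaves two vertices outside `A ∪ insert u D`, so uncrossing
gives `conn (insert u (A ∩ D)) ≤ 2`. The triangle and the `C`-side vector avoid `A ∩ D` and differ
at `u`. -/
theorem ncard_inter_le_one (h : S.IsSplit t v u w A B) (h' : S.IsSplit t u v w C D)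
    (h3 : S.IsKConnected 3) (ht : t ∈ S.supported {v, u, w})
    (hBC : (B ∩ C).Nonempty) : (A ∩ D).ncard ≤ 1 := by
  obtain ⟨z, hzB, hzC⟩ := hBC
  obtain ⟨c, hc, hcu⟩ := h'.exists_left
  have huv : u ≠ v := h.ne_of_mem_left h.mem_left
  have hle := conn_inter_le_two h3 h.conn_left h'.conn_insert_right
    (two_le_ncard (x := u) (y := w) (by simp) (Or.inr (Or.inr h'.mem_right))
      fun h0 => h.notMem_of_mem_right h.mem_right (h0 ▸ h.mem_left))
    (two_le_ncard (x := v) (y := z)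
      (by simp [h.notMem_left, huv.symm, h'.notMem_of_mem_left h'.mem_left])
      (by simp [h.notMem_of_mem_right hzB, h'.ne_of_mem_left hzC, h'.notMem_of_mem_left hzC])
      (h.ne_of_mem_right hzB).symm)
  have heq : A ∩ insert u D = insert u (A ∩ D) := by
    rw [Set.insert_inter_distrib, Set.insert_eq_of_mem h.mem_left]
  rw [heq] at hle
  refine ncard_le_one_of_kForm_eq_one h3 (fun hu => h'.notMem_right hu.2)
    (two_le_ncard (x := v) (y := w) (fun hv => h.notMem_left hv.1)
      (fun hw => h.notMem_of_mem_right h.mem_right hw.1)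
      (h.ne_of_mem_right h.mem_right).symm) hle hc ht ?_ ?_ hcu
  · rw [Set.disjoint_left]
    rintro y (rfl | hy) ⟨hyA, hyD⟩
    · exact h'.notMem_right hyD
    · exact h'.notMem_of_mem_left hy hyD
  · rw [Set.disjoint_left]
    rintro y (hy | hy | hy) ⟨hyA, hyD⟩
    · exact h.notMem_left (hy ▸ hyA)
    · exact h'.notMem_right (hy ▸ hyD)
    · exact h.notMem_of_mem_right h.mem_right (hy ▸ hyA)

/-- Now `D` lies in `B`, so the `D`-side vector shows that adding `u` to `B` does not raise `conn`.
The complement is `insert v (A \ {u})`, and `A \ {u}` is avoided by the triangle and the `B`-side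
vector, which differ at `v`. -/
theorem ncard_le_two_of_inter_empty (h : S.IsSplit t v u w A B) (h' : S.IsSplit t u v w C D)
    (h3 : S.IsKConnected 3) (ht : t ∈ S.supported {v, u, w})
    (hAD : ¬ (A ∩ D).Nonempty) : A.ncard ≤ 2 := by
  obtain ⟨b, hb, hbv⟩ := h.exists_right
  obtain ⟨d, hd, hdu⟩ := h'.exists_right
  have huB : u ∉ B := h.notMem_of_mem_left h.mem_left
  have hvu : v ≠ u := (h.ne_of_mem_left h.mem_left).symm
  have hD : insert u D ⊆ insert u B := Set.insert_subset_insert fun z hz =>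
    (h.mem_or_mem fun hzv => h'.notMem_of_mem_left h'.mem_left (hzv ▸ hz)).resolve_left
      fun hzA => hAD ⟨z, hzA, hz⟩
  have hle : S.conn (insert u B) ≤ 2 :=
    (conn_insert_le huB (supported_mono hD hd) ((kForm_eq_one_iff _ _).1 hdu).1).trans
      h.symm.conn_left
  have hc : (insert u B)ᶜ = insert v (A \ {u}) := by
    ext z
    simp only [Set.mem_compl_iff, Set.mem_insert_iff, Set.mem_sdiff, Set.mem_singleton_iff]
    constructor
    · intro hz
      by_cases hzv : z = v
      · exact Or.inl hzv
      · exact Or.inr ⟨(h.mem_or_mem hzv).resolve_right fun h => hz (Or.inr h),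
          fun h => hz (Or.inl h)⟩
    · rintro (rfl | ⟨hzA, hzu⟩) (h1 | h1)
      · exact hvu h1
      · exact h.notMem_right h1
      · exact hzu h1
      · exact h.notMem_of_mem_left hzA h1
  rw [← conn_compl, hc] at hle
  have := ncard_le_one_of_kForm_eq_one h3 (X := A \ {u}) (fun hv => h.notMem_left hv.1)
    (two_le_ncard (x := v) (y := u) (fun hv => h.notMem_left hv.1) (by simp) hvu)
    hle hb ht ?_ ?_ hbv
  · rw [Set.ncard_sdiff_singleton_of_mem h.mem_left] at this
    omega
  · rw [Set.disjoint_left]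
    rintro y (rfl | hy) ⟨hyA, -⟩
    · exact h.notMem_left hyA
    · exact h.notMem_of_mem_left hyA hy
  · rw [Set.disjoint_left]
    rintro y (hy | hy | hy) ⟨hyA, hyu⟩
    · exact h.notMem_left (hy ▸ hyA)
    · exact hyu hy
    · exact h.notMem_of_mem_right h.mem_right (hy ▸ hyA)

/-- The vertices `w` and `z` allow two uncrossings. The one without `v` shows that `A ∩ C` is a
single vertex `r`; the one with `v` then makes `{v, u, r}` a triangle. -/
theorem exists_tri_of_nonempty (h : S.IsSplit t v u w A B) (h' : S.IsSplit t u v w C D)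
    (h3 : S.IsKConnected 3) (hV : 5 ≤ Fintype.card V) (ht : t ∈ S.supported {v, u, w})
    (hAC : (A ∩ C).Nonempty) {z : V} (hzB : z ∈ B) (hzD : z ∈ D) (hzw : z ≠ w) :
    ∃ r ∈ A ∩ C, S.Tri v u r := by
  obtain ⟨d, hd, hdu⟩ := h'.exists_right
  have huv : u ≠ v := h.ne_of_mem_left h.mem_left
  have hwA := h.notMem_of_mem_right h.mem_right
  have hwC := h'.notMem_of_mem_right h'.mem_right
  have hwu := h'.ne_of_mem_right h'.mem_right
  have hwv := h.ne_of_mem_right h.mem_right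
  have hzA := h.notMem_of_mem_right hzB
  have hzC := h'.notMem_of_mem_right hzD
  have hzu := h'.ne_of_mem_right hzD
  have hzv := h.ne_of_mem_right hzB
  have hle := conn_inter_le_two h3 h.conn_left h'.conn_insert_left
    (two_le_ncard (x := u) (y := v) (by simp) (Or.inr (Or.inr h'.mem_left)) huv)
    (two_le_ncard (x := w) (y := z) (by simp [hwA, hwC, hwu]) (by simp [hzA, hzC, hzu]) hzw.symm)
  have hle2 := conn_inter_le_two h3 h.conn_insert_left h'.conn_insert_left
    (two_le_ncard (x := u) (y := v) (by simp) (by simp) huv)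
    (two_le_ncard (x := w) (y := z) (by simp [hwA, hwC, hwu, hwv])
      (by simp [hzA, hzC, hzu, hzv]) hzw.symm)
  have heq : A ∩ insert u C = insert u (A ∩ C) := by
    rw [Set.insert_inter_distrib, Set.insert_eq_of_mem h.mem_left]
  have heq2 : insert v A ∩ insert u C = insert v (insert u (A ∩ C)) := by
    rw [Set.insert_inter_distrib, Set.insert_inter_distrib, Set.insert_eq_of_mem h.mem_left,
      Set.insert_eq_of_mem (Set.mem_insert_of_mem u h'.mem_left)]
  rw [heq] at hle
  rw [heq2] at hle2
  have h1 := ncard_le_one_of_kForm_eq_one h3 (fun hu => h'.notMem_left hu.2)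
    (two_le_ncard (x := w) (y := z) (fun hw => hwA hw.1) (fun hz => hzA hz.1) hzw.symm)
    hle hd ht ?_ ?_ hdu
  · obtain ⟨r, hr⟩ := hAC
    have hre : A ∩ C = {r} := by
      refine (Set.eq_of_subset_of_ncard_le (Set.singleton_subset_iff.2 hr) ?_).symm
      rwa [Set.ncard_singleton]
    rw [hre] at hle2
    exact ⟨r, hr, tri_of_conn_le h3 hV huv.symm (h.ne_of_mem_left hr.1).symm
      (h'.ne_of_mem_left hr.2).symm hle2⟩
  · rw [Set.disjoint_left]
    rintro y (rfl | hy) ⟨hyA, hyC⟩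
    · exact h'.notMem_left hyC
    · exact h'.notMem_of_mem_right hy hyC
  · rw [Set.disjoint_left]
    rintro y (hy | hy | hy) ⟨hyA, hyC⟩
    · exact h.notMem_left (hy ▸ hyA)
    · exact h'.notMem_left (hy ▸ hyC)
    · exact hwA (hy ▸ hyA)

end IsSplit

/-- Two essential vertices of a triangle yield a triangle meeting it in exactly two vertices. -/
theorem exists_tri_of_two_essential [DecidableEq V] (h3 : S.IsKConnected 3)
    (hV : 5 ≤ Fintype.card V) {v u w : V} (hT : S.Tri v u w) (hv : ¬ S.NonEssential v)
    (hu : ¬ S.NonEssential u) :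
    ∃ r, r ≠ v ∧ r ≠ u ∧ r ≠ w ∧ (S.Tri v u r ∨ S.Tri v w r ∨ S.Tri u w r) := by
  obtain ⟨hvu, hvw, huw, t, htL, hs⟩ := hT
  obtain ⟨A, B, h⟩ := exists_isSplit h3 hV htL hs hvu hvw hv
  obtain ⟨C, D, h'⟩ := exists_isSplit h3 hV htL (hs.trans (Set.insert_comm _ _ _)) hvu.symm huw hu
  have ht : t ∈ S.supported {v, u, w} := ⟨htL, hs.le⟩
  have ht' : t ∈ S.supported {u, v, w} := ⟨htL, (hs.trans (Set.insert_comm _ _ _)).le⟩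
  have hwA := h.notMem_of_mem_right h.mem_right
  have hwC := h'.notMem_of_mem_right h'.mem_right
  have kA : A.ncard ≤ 2 → ∃ r, r ≠ v ∧ r ≠ u ∧ r ≠ w ∧
      (S.Tri v u r ∨ S.Tri v w r ∨ S.Tri u w r) := fun hA => by
    obtain ⟨r, hr, hT⟩ := h.exists_tri h3 hV hA
    exact ⟨r, hT.2.1.symm, hT.2.2.1.symm, fun hrw => hwA (hrw ▸ hr), Or.inl hT⟩
  -- An empty crossing cell makes one side have two vertices, which already yields a triangle.
  -- Otherwise both `A ∩ D` and `C ∩ B` are single vertices.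
  by_cases hAD : (A ∩ D).Nonempty
  swap
  · exact kA (h.ncard_le_two_of_inter_empty h' h3 ht hAD)
  by_cases hCB : (C ∩ B).Nonempty
  swap
  · obtain ⟨r, hr, hT⟩ := h'.exists_tri h3 hV (h'.ncard_le_two_of_inter_empty h h3 ht' hCB)
    exact ⟨r, hT.2.2.1.symm, hT.2.1.symm, fun hrw => hwC (hrw ▸ hr), Or.inl hT.swap⟩
  have hAD1 := h.ncard_inter_le_one h' h3 ht (by rwa [Set.inter_comm])
  have hCB1 := h'.ncard_inter_le_one h h3 ht' (by rwa [Set.inter_comm])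
  by_cases hAC : (A ∩ C).Nonempty
  swap
  · refine kA (ncard_le_two_of_subset_insert hAD1 (p := u) fun z hz => ?_)
    by_cases hzu : z = u
    · exact Or.inl hzu
    · exact Or.inr ⟨hz, (h'.mem_or_mem hzu).resolve_left fun hzC => hAC ⟨z, hz, hzC⟩⟩
  -- If `w` is the only vertex of `B ∩ D`, then `B` consists of `w` and `C ∩ B`, so `B` is the small
  -- side.
  by_cases hBD : ∃ z ∈ B ∩ D, z ≠ w
  · obtain ⟨z, ⟨hzB, hzD⟩, hzw⟩ := hBD
    obtain ⟨r, hr, hT⟩ := h.exists_tri_of_nonempty h' h3 hV ht hAC hzB hzD hzw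
    exact ⟨r, hT.2.1.symm, hT.2.2.1.symm, fun hrw => hwA (hrw ▸ hr.1), Or.inl hT⟩
  · have hB : B.ncard ≤ 2 := ncard_le_two_of_subset_insert hCB1 (p := w) fun z hz => by
      by_cases hzw : z = w
      · exact Or.inl hzw
      · have hzu : z ≠ u := fun hzu => h.notMem_of_mem_right hz (hzu ▸ h.mem_left)
        exact Or.inr ⟨(h'.mem_or_mem hzu).resolve_right fun hzD => hBD ⟨z, ⟨hz, hzD⟩, hzw⟩, hz⟩
    obtain ⟨r, hr, hT⟩ := h.symm.exists_tri h3 hV hB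
    exact ⟨r, hT.2.1.symm, fun hru => h.notMem_of_mem_right hr (hru ▸ h.mem_left),
      hT.2.2.1.symm, Or.inr (Or.inl hT)⟩

/-! ### Overlapping triangles -/

theorem ncard_compl_le_one_of_conn_le_one (h3 : S.IsKConnected 3) {X : Set V}
    (hX : 2 ≤ X.ncard) (h : S.conn X ≤ 1) : Xᶜ.ncard ≤ 1 := by
  by_contra! hc
  have := two_le_conn h3 hX hc
  omega

/-- The two triangles differ at `p`, and both lie in `insert p X`. -/
theorem conn_insert_lt_of_tri (h3 : S.IsKConnected 3) (hV : 5 ≤ Fintype.card V) {p q r s : V}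
    {X : Set V} (hr : S.Tri p q r) (hs : S.Tri p q s) (hrs : r ≠ s) (hp : p ∉ X) (hq : q ∈ X)
    (hrX : r ∈ X) (hsX : s ∈ X) : S.conn (insert p X) < S.conn X := by
  obtain ⟨hpq, hpr, hqr, a, ha, has⟩ := hr
  obtain ⟨-, -, -, b, hb, hbs⟩ := hs
  refine conn_insert_lt hp ⟨ha, ?_⟩ ⟨hb, ?_⟩
    (kForm_eq_one_of_triangles h3 hV hpq ⟨hpr.symm, hqr.symm⟩ hrs ha hb has hbs)
  · rw [has]
    exact Set.insert_subset_insert (Set.insert_subset hq (Set.singleton_subset_iff.2 hrX))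
  · rw [hbs]
    exact Set.insert_subset_insert (Set.insert_subset hq (Set.singleton_subset_iff.2 hsX))

/-- The triangles `{p, q, r}` and `{q, r, s}` differ at `r` and have their other vertices in `insert
p A`. Adding `r` thus drops `conn` to at most 1, leaving at most one vertex outside; so `B` has two
vertices and forms a triangle with `p`. -/
theorem IsSplit.exists_tri_right (h3 : S.IsKConnected 3) (hV : 5 ≤ Fintype.card V)
    {p q r s : V} {t : V → KK} {A B : Set V} (h : S.IsSplit t p q r A B) (ht : t ∈ S.L)
    (hs : Function.support t = {p, q, r}) (hT : S.Tri q r s) (hsp : s ≠ p) (hsA : s ∈ A) :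
    ∃ z, z ≠ p ∧ z ≠ q ∧ z ≠ r ∧ z ≠ s ∧ S.Tri p r z := by
  have hrp := h.ne_of_mem_right h.mem_right
  have hqp := h.ne_of_mem_left h.mem_left
  have hrA := h.notMem_of_mem_right h.mem_right
  have hT₁ : S.Tri p q r := ⟨hqp.symm, hrp.symm, hT.1, t, ht, hs⟩
  have hlt : S.conn (insert r (insert p A)) < S.conn (insert p A) :=
    conn_insert_lt_of_tri h3 hV hT₁.reverse hT.swap hsp.symm (by simp [hrp, hrA])
      (by simp [h.mem_left]) (by simp) (by simp [hsA])
  have hc := h.conn_insert_left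
  have h2 := ncard_compl_le_one_of_conn_le_one h3 (X := insert r (insert p A))
    (two_le_ncard (x := r) (y := p) (by simp) (by simp) hrp) (by omega)
  have hB : B.ncard ≤ 2 := ncard_le_two_of_subset_insert h2 (p := r) fun z hz => by
    by_cases hzr : z = r
    · exact Or.inl hzr
    · refine Or.inr ?_
      simp [hzr, h.ne_of_mem_right hz, h.notMem_of_mem_right hz]
  obtain ⟨z, hz, hT⟩ := h.symm.exists_tri h3 hV hB
  exact ⟨z, hT.2.1.symm, fun hzq => h.notMem_of_mem_right hz (hzq ▸ h.mem_left),
    hT.2.2.1.symm, fun hzs => h.notMem_of_mem_right hz (hzs ▸ hsA), hT⟩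

/-- An essential vertex of a triangle `{p, q, r}` that lies outside a triangle `{q, r, s}` lies
in a further triangle. -/
theorem exists_tri_of_essential [DecidableEq V] (h3 : S.IsKConnected 3)
    (hV : 5 ≤ Fintype.card V) {p q r s : V} (hT : S.Tri p q r) (hT' : S.Tri q r s)
    (hsp : s ≠ p) (hp : ¬ S.NonEssential p) :
    ∃ z, z ≠ p ∧ z ≠ q ∧ z ≠ r ∧ z ≠ s ∧ (S.Tri p q z ∨ S.Tri p r z) := by
  obtain ⟨hpq, hpr, hqr, t, ht, hs⟩ := hT
  obtain ⟨A, B, h⟩ := exists_isSplit h3 hV ht hs hpq hpr hp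
  rcases h.mem_or_mem hsp with hsA | hsB
  · obtain ⟨z, h1, h2, h4, h5, h6⟩ := h.exists_tri_right h3 hV ht hs hT' hsp hsA
    exact ⟨z, h1, h2, h4, h5, Or.inr h6⟩
  · obtain ⟨z, h1, h2, h4, h5, h6⟩ := h.symm.exists_tri_right h3 hV ht
      (hs.trans (by rw [Set.pair_comm])) hT'.swap hsp hsB
    exact ⟨z, h1, h4, h2, h5, Or.inl h6⟩

/-- There is no third triangle at `a` avoiding the other vertices of two triangles `{a, b, c}`
and `{a, b, d}`. -/
theorem Tri.false_of_tri (h3 : S.IsKConnected 3) (hV : 5 ≤ Fintype.card V) {a b c d x y : V}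
    (h1 : S.Tri a b c) (h2 : S.Tri a b d) (hcd : c ≠ d) (h : S.Tri a x y) (hxb : x ≠ b)
    (hxc : x ≠ c) (hxd : x ≠ d) (hyb : y ≠ b) (hyc : y ≠ c) (hyd : y ≠ d) : False := by
  obtain ⟨hab, hac, hbc, t₁, ht₁, hs₁⟩ := h1
  obtain ⟨-, -, -, t₂, ht₂, hs₂⟩ := h2
  obtain ⟨hax, hay, -, t, ht, hs⟩ := h
  -- The first two triangles differ at `a`, while the third meets each only in `a` and would have to
  -- agree with both.
  have hk := kForm_eq_one_of_triangles h3 hV hab ⟨hac.symm, hbc.symm⟩ hcd ht₁ ht₂ hs₁ hs₂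
  obtain ⟨h10, h20, hne⟩ := (kForm_eq_one_iff _ _).1 hk
  have h0 : t a ≠ 0 := by rw [← Function.mem_support, hs]; simp
  have key : ∀ e, x ≠ e → y ≠ e → ({a, x, y} : Set V) ∩ {a, b, e} ⊆ {a} := by
    rintro e hxe hye z ⟨hz | hz | hz, hz' | hz' | hz'⟩ <;> subst hz <;>
      first | rfl | exact hz' | exact absurd hz' (by assumption)
  exact hne ((eq_of_inter_subset ⟨ht, hs.le⟩ ⟨ht₁, hs₁.le⟩ (key c hxc hyc) h0 h10).symm.trans
    (eq_of_inter_subset ⟨ht, hs.le⟩ ⟨ht₂, hs₂.le⟩ (key d hxd hyd) h0 h20))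

/-! ### Recognizing cyclic systems -/

open Fin.CommRing in
-- Let `t i` be the triangle centred at `e i`. At `e i` the vectors `t (i - 1)` and `t (i + 1)`
-- agree by orthogonality, and `t i` differs from them. Their common value defines an Eulerian
-- vector whose fundamental basis is `t`, and the supports of `t` describe a cycle.
theorem isCyclic_of_tri (h3 : S.IsKConnected 3) (hV : 5 ≤ Fintype.card V) (m : ℕ)
    (e : Fin (m + 5) ≃ V) (hT : ∀ i, S.Tri (e i) (e (i + 1)) (e (i + 2))) : S.IsCyclic := by
  -- Having at least five vertices keeps the supports of `t (i - 1)` and `t (i + 1)` from meeting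
  -- outside `e i`.
  have n1 : (1 : Fin (m + 5)) ≠ 0 := by simp
  have n2 : (2 : Fin (m + 5)) ≠ 0 := by
    simp [Fin.ext_iff, Nat.mod_eq_of_lt (show 2 < m + 5 by omega)]
  have n3 : (3 : Fin (m + 5)) ≠ 0 := by
    simp [Fin.ext_iff, Nat.mod_eq_of_lt (show 3 < m + 5 by omega)]
  have n4 : (4 : Fin (m + 5)) ≠ 0 := by
    simp [Fin.ext_iff, Nat.mod_eq_of_lt (show 4 < m + 5 by omega)]
  have hT' : ∀ i, ∃ t ∈ S.L, Function.support t = {e (i - 1), e i, e (i + 1)} := fun i => by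
    obtain ⟨-, -, -, h⟩ := hT (i - 1)
    rwa [sub_add_cancel, show i - 1 + 2 = i + 1 by ring] at h
  choose t ht hs using hT'
  have hsupp : ∀ i j, t i (e j) ≠ 0 ↔ j = i - 1 ∨ j = i ∨ j = i + 1 := fun i j => by
    rw [← Function.mem_support, hs]
    simp [e.injective.eq_iff]
  have hsame : ∀ i, t (i - 1) (e i) = t (i + 1) (e i) := fun i => by
    refine eq_of_inter_subset ⟨ht (i - 1), (hs (i - 1)).le⟩ ⟨ht (i + 1), (hs (i + 1)).le⟩ ?_
      ((hsupp _ _).2 (by simp)) ((hsupp _ _).2 (by simp))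
    rintro w ⟨hw, hw'⟩
    obtain ⟨j, rfl⟩ := e.surjective w
    simp only [Set.mem_insert_iff, Set.mem_singleton_iff, e.injective.eq_iff] at hw hw' ⊢
    rcases hw with h | h | h
    · subst h
      rcases hw' with h | h | h
      · exact absurd (by linear_combination -h) n2
      · exact absurd (by linear_combination -h) n3
      · exact absurd (by linear_combination -h) n4
    · subst h
      rcases hw' with h | h | h
      · exact absurd (by linear_combination -h) n1
      · exact absurd (by linear_combination -h) n2
      · exact absurd (by linear_combination -h) n3
    · rw [h, sub_add_cancel]
  have hdiff : ∀ i, kForm (t i (e i)) (t (i - 1) (e i)) = 1 := fun i => by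
    refine kForm_eq_one_of_triangles h3 hV (p := e i) (q := e (i - 1)) (r := e (i + 1))
      (s := e (i - 1 - 1)) ?_ ⟨?_, ?_⟩ ?_ (ht i) (ht (i - 1)) ?_ ?_
    · exact fun h => n1 (by linear_combination e.injective h)
    · exact fun h => n1 (by linear_combination e.injective h)
    · exact fun h => n2 (by linear_combination e.injective h)
    · exact fun h => n3 (by linear_combination e.injective h)
    · rw [hs]
      exact Set.insert_comm _ _ _
    · rw [hs, sub_add_cancel]
      ext w
      simp only [Set.mem_insert_iff, Set.mem_singleton_iff]
      tauto
  let a : V → KK := fun v => t (e.symm v - 1) v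
  have hae : ∀ i, a (e i) = t (i - 1) (e i) := fun i => by simp [a]
  have hdiag : ∀ i, kForm (t i (e i)) (a (e i)) = 1 := fun i => by rw [hae, hdiff]
  have hoff : ∀ i j, j ≠ i → kForm (t i (e j)) (a (e j)) = 0 := fun i j hij => by
    by_cases h0 : t i (e j) = 0
    · rw [h0, map_zero, LinearMap.zero_apply]
    · rw [kForm_eq_zero_iff h0, hae]
      right
      rcases (hsupp i j).1 h0 with h | h | h
      · rw [hsame, h, sub_add_cancel]
      · exact absurd h hij
      · rw [h, add_sub_cancel_right]
  refine ⟨(SimpleGraph.cycleGraph (m + 5)).comap e.symm,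
    ⟨a, ⟨fun v => ?_, ?_⟩, fun v => t (e.symm v), ?_, ?_⟩, m + 5, by omega,
    ⟨SimpleGraph.Iso.comap e.symm _⟩⟩
  · obtain ⟨i, rfl⟩ := e.surjective v
    exact ((kForm_eq_one_iff _ _).1 (hdiag i)).2.1
  · rintro X ⟨v, hv⟩ hX
    obtain ⟨i, rfl⟩ := e.surjective v
    -- Pairing with `t i` isolates the coordinate `e i`, where the form is 1.
    have h := S.isotropic _ (ht i) _ hX
    rw [vForm_apply, Finset.sum_eq_single (e i), Set.indicator_of_mem hv, hdiag] at h
    · exact one_ne_zero h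
    · intro w _ hw
      obtain ⟨j, rfl⟩ := e.surjective w
      by_cases hj : e j ∈ X
      · rw [Set.indicator_of_mem hj, hoff i j fun h => hw (h ▸ rfl)]
      · rw [Set.indicator_of_notMem hj, map_zero]
    · simp
  · intro v
    obtain ⟨i, rfl⟩ := e.surjective v
    simp only [e.symm_apply_apply]
    refine ⟨ht i, hdiag i, fun w hw => ?_⟩
    obtain ⟨j, rfl⟩ := e.surjective w
    exact hoff i j fun h => hw (h ▸ rfl)
  · intro v w
    obtain ⟨i, rfl⟩ := e.surjective v
    obtain ⟨j, rfl⟩ := e.surjective w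
    simp only [SimpleGraph.comap_adj, e.symm_apply_apply, hsupp, SimpleGraph.cycleGraph_adj,
      e.injective.ne_iff]
    constructor
    · rintro (h | h)
      · exact ⟨fun hij => n1 (by linear_combination hij - h), Or.inl (by linear_combination -h)⟩
      · exact ⟨fun hij => n1 (by linear_combination -hij - h),
          Or.inr (Or.inr (by linear_combination h))⟩
    · rintro ⟨hij, h | h | h⟩
      · exact Or.inl (by linear_combination -h)
      · exact absurd h.symm hij
      · exact Or.inr (by linear_combination h)

/-- A 3-connected system with five vertices is cyclic. -/
theorem isCyclic_of_card_eq_five (h3 : S.IsKConnected 3) (hV : Fintype.card V = 5) :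
    S.IsCyclic := by
  refine isCyclic_of_tri h3 hV.ge 0 (Fintype.equivFinOfCardEq hV).symm fun i => ?_
  have hd : ∀ i : Fin (0 + 5), i ≠ i + 1 ∧ i ≠ i + 2 ∧ i + 1 ≠ i + 2 := by decide
  obtain ⟨h1, h2, h3'⟩ := hd i
  set e := (Fintype.equivFinOfCardEq hV).symm
  have hn := ncard_insert_pair (e.injective.ne h1) (e.injective.ne h2) (e.injective.ne h3')
  refine tri_of_conn_le h3 hV.ge (e.injective.ne h1) (e.injective.ne h2) (e.injective.ne h3') ?_
  rw [← conn_compl]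
  refine (S.conn_le_ncard _).trans ?_
  have := ncard_compl_add {e i, e (i + 1), e (i + 2)}
  omega

/-! ### Tight paths as vertex sequences -/

/-- The vertices `v 0, …, v (k + 1)` are distinct and any three consecutive ones form a
triangle. -/
def IsPathSeq (S : IsotropicSystem V) (v : ℕ → V) (k : ℕ) : Prop :=
  Set.InjOn v (Set.Iic (k + 1)) ∧ ∀ i < k, S.Tri (v i) (v (i + 1)) (v (i + 2))

namespace IsPathSeq

variable {v : ℕ → V} {k : ℕ}

theorem ne (h : S.IsPathSeq v k) {i j : ℕ} (hi : i ≤ k + 1) (hj : j ≤ k + 1) (hij : i ≠ j) :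
    v i ≠ v j :=
  h.1.ne hi hj hij

theorem notMem_image (h : S.IsPathSeq v k) {i : ℕ} {s : Set ℕ} (hi : i ≤ k + 1)
    (hs : ∀ j ∈ s, j ≤ k + 1) (his : i ∉ s) : v i ∉ v '' s := by
  rintro ⟨j, hj, hji⟩
  exact his (h.1 (hs j hj) hi hji ▸ hj)

/-- A pair has `conn` at most 2, and each next vertex is added through a triangle inside the
segment. -/
theorem conn_image_Icc_le (h : S.IsPathSeq v k) {a b : ℕ} (hab : a + 1 ≤ b) (hb : b ≤ k + 1) :
    S.conn (v '' Set.Icc a b) ≤ 2 := by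
  induction b, hab using Nat.le_induction with
  | base =>
    refine (S.conn_le_ncard _).trans ?_
    have := Set.ncard_image_le (f := v) (Set.toFinite (Set.Icc a (a + 1)))
    rw [← Finset.coe_Icc, Set.ncard_coe_finset, Nat.card_Icc, Finset.coe_Icc] at this
    omega
  | succ b hab ih =>
    have ih := ih (by omega)
    obtain ⟨c, rfl⟩ : ∃ c, b = c + 1 := ⟨b - 1, by omega⟩
    obtain ⟨-, -, -, t, ht, hs⟩ := h.2 c (by omega)
    have he : Set.Icc a (c + 1 + 1) = insert (c + 2) (Set.Icc a (c + 1)) := by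
      ext i; simp only [Set.mem_Icc, Set.mem_insert_iff]; omega
    rw [he, Set.image_insert_eq]
    refine (conn_insert_le (h.notMem_image (by omega) ?_ ?_) ⟨ht, ?_⟩ (a := t) ?_).trans ih
    · intro j hj; have := hj.2; omega
    · simp
    · rw [hs]
      rintro w (rfl | rfl | rfl)
      · exact Or.inr ⟨c, ⟨by omega, by omega⟩, rfl⟩
      · exact Or.inr ⟨c + 1, ⟨by omega, by omega⟩, rfl⟩
      · exact Or.inl rfl
    · rw [← Function.mem_support, hs]; simp

theorem ncard_image (h : S.IsPathSeq v k) {s : Finset ℕ} (hs : ∀ j ∈ s, j ≤ k + 1) :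
    (v '' s).ncard = s.card := by
  rw [Set.InjOn.ncard_image fun i hi j hj => h.1 (hs i hi) (hs j hj), Set.ncard_coe_finset]

/-- Three further vertices completing the complement of a segment of the path form a triangle. -/
theorem tri_of_compl (h : S.IsPathSeq v k) (h3 : S.IsKConnected 3) (hV : 5 ≤ Fintype.card V)
    {a b : ℕ} (hab : a + 1 ≤ b) (hb : b ≤ k + 1) {x y z : V} (hxy : x ≠ y) (hxz : x ≠ z)
    (hyz : y ≠ z) (hc : (v '' Set.Icc a b)ᶜ = {x, y, z}) : S.Tri x y z := by
  refine tri_of_conn_le h3 hV hxy hxz hyz ?_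
  rw [← hc, conn_compl]
  exact h.conn_image_Icc_le hab hb

/-- A tight path whose ends together with the second vertex form a triangle closes up. -/
theorem isCyclic (h : S.IsPathSeq v k) (h3 : S.IsKConnected 3) (hV : 5 ≤ Fintype.card V)
    (hk : 3 ≤ k) (hT : S.Tri (v (k + 1)) (v 0) (v 1)) : S.IsCyclic := by
  obtain ⟨m, rfl⟩ : ∃ m, k = m + 3 := ⟨k - 3, by omega⟩
  have h0 : S.Tri (v 0) (v 1) (v 2) := h.2 0 (by omega)
  -- The triangles before and after the edge `v 0, v 1` differ at `v 0`, so adding `v 0` last lowers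
  -- `conn`; at most one vertex is off the path.
  have hc1 : S.conn (v '' Set.Icc 0 (m + 4)) ≤ 1 := by
    have he : Set.Icc 0 (m + 4) = insert 0 (Set.Icc 1 (m + 4)) := by
      ext i; simp only [Set.mem_Icc, Set.mem_insert_iff]; omega
    have hlt : S.conn (insert (v 0) (v '' Set.Icc 1 (m + 4))) < S.conn (v '' Set.Icc 1 (m + 4)) :=
      conn_insert_lt_of_tri h3 hV h0 hT.rotate (h.ne (by omega) (by omega) (by omega))
        (h.notMem_image (by omega) (fun j hj => hj.2) (by simp))
        ⟨1, ⟨by omega, by omega⟩, rfl⟩ ⟨2, ⟨by omega, by omega⟩, rfl⟩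
        ⟨_, ⟨by omega, by omega⟩, rfl⟩
    have := h.conn_image_Icc_le (a := 1) (b := m + 4) (by omega) (by omega)
    rw [he, Set.image_insert_eq]
    omega
  have hcard : (v '' Set.Icc 0 (m + 4)).ncard = m + 5 := by
    have := h.ncard_image (s := Finset.Icc 0 (m + 4)) fun j hj => (Finset.mem_Icc.1 hj).2
    rwa [Finset.coe_Icc, Nat.card_Icc] at this
  have hcompl := ncard_compl_le_one_of_conn_le_one h3 (by omega) hc1
  have hsub : ∀ w ∉ v '' Set.Icc 0 (m + 4), (v '' Set.Icc 0 (m + 4))ᶜ = {w} := fun w hw =>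
    (Set.eq_of_subset_of_ncard_le (Set.singleton_subset_iff.2 hw)
      (by rwa [Set.ncard_singleton])).symm
  have hsurj : ∀ w, ∃ i ≤ m + 4, v i = w := by
    by_contra! hw
    obtain ⟨w, hw⟩ := hw
    have hw0 : w ∉ v '' Set.Icc 0 (m + 4) := by
      rintro ⟨i, hi, hiw⟩
      exact hw i hi.2 hiw
    -- An outside vertex `w` would give this triangle as the complement of a segment, and three
    -- triangles at `v (m + 4)` would then conflict.
    have hf : S.Tri (v (m + 4)) (v 0) w := by
      refine h.tri_of_compl h3 hV (a := 1) (b := m + 3) (by omega) (by omega)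
        (h.ne (by omega) (by omega) (by omega)) (hw _ le_rfl) (hw _ (by omega)) ?_
      ext x
      constructor
      · intro hx
        by_cases hx0 : x ∈ v '' Set.Icc 0 (m + 4)
        · obtain ⟨i, hi, rfl⟩ := hx0
          have hi' : ¬ (1 ≤ i ∧ i ≤ m + 3) := fun hi' => hx ⟨i, hi', rfl⟩
          have := hi.2
          rcases (by omega : i = m + 4 ∨ i = 0) with rfl | rfl <;> simp
        · have : x ∈ (v '' Set.Icc 0 (m + 4))ᶜ := hx0
          rw [hsub w hw0] at this
          exact Or.inr (Or.inr this)
      · rintro (rfl | rfl | rfl)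
        · exact h.notMem_image (by omega) (fun j hj => by have := hj.2; omega) (by simp)
        · exact h.notMem_image (by omega) (fun j hj => by have := hj.2; omega) (by simp)
        · rintro ⟨i, hi, hiw⟩
          exact hw i (hi.2.trans (by omega)) hiw
    exact hf.false_of_tri h3 hV hT (hw 1 (by omega)).symm (h.2 (m + 2) (by omega)).reverse
      (h.ne (by omega) (by omega) (by omega)) (hw _ (by omega))
      (h.ne (by omega) (by omega) (by omega)) (h.ne (by omega) (by omega) (by omega))
      (hw _ (by omega)) (h.ne (by omega) (by omega) (by omega))
  have hlast : S.Tri (v (m + 3)) (v (m + 4)) (v 0) := by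
    refine h.tri_of_compl h3 hV (a := 1) (b := m + 2) (by omega) (by omega)
      (h.ne (by omega) (by omega) (by omega)) (h.ne (by omega) (by omega) (by omega))
      (h.ne (by omega) (by omega) (by omega)) ?_
    ext x
    constructor
    · intro hx
      obtain ⟨i, hi, rfl⟩ := hsurj x
      have hi' : ¬ (1 ≤ i ∧ i ≤ m + 2) := fun hi' => hx ⟨i, hi', rfl⟩
      rcases (by omega : i = m + 4 ∨ i = m + 3 ∨ i = 0) with rfl | rfl | rfl <;> simp
    · rintro (rfl | rfl | rfl) <;>
        exact h.notMem_image (by omega) (fun j hj => by have := hj.2; omega) (by simp)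
  let e : Fin (m + 5) ≃ V := Equiv.ofBijective (fun i => v i) ⟨fun i j hij =>
    Fin.ext (h.1 (show i.1 ≤ m + 3 + 1 by omega) (show j.1 ≤ m + 3 + 1 by omega) hij),
    fun w => by
      obtain ⟨i, hi, hw⟩ := hsurj w
      exact ⟨⟨i, by omega⟩, hw⟩⟩
  refine isCyclic_of_tri h3 hV m e fun i => ?_
  change S.Tri (v i) (v (i + 1 : Fin (m + 5))) (v (i + 2 : Fin (m + 5)))
  have e1 : (i + 1 : Fin (m + 5)).val = (i.val + 1) % (m + 5) := by
    rw [Fin.val_add]; simp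
  have e2 : (i + 2 : Fin (m + 5)).val = (i.val + 2) % (m + 5) := by
    rw [Fin.val_add]; simp
  rw [e1, e2]
  rcases (by omega : i.val < m + 3 ∨ i.val = m + 3 ∨ i.val = m + 4) with hi | hi | hi
  · rw [Nat.mod_eq_of_lt (by omega), Nat.mod_eq_of_lt (by omega)]
    exact h.2 _ hi
  · rw [hi, Nat.mod_eq_of_lt (by omega), Nat.mod_self]
    exact hlast
  · rw [hi, Nat.mod_self, show m + 4 + 2 = m + 5 + 1 by omega, Nat.add_mod_left,
      Nat.mod_eq_of_lt (by omega)]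
    exact hT

/-- Four triangles around a common vertex of a tight path force the octahedral cyclic system. -/
theorem isCyclic_of_tri_zero_two_four (h : S.IsPathSeq v 3) (h3 : S.IsKConnected 3)
    (hV : 6 ≤ Fintype.card V) (hT : S.Tri (v 0) (v 2) (v 4)) : S.IsCyclic := by
  have hV5 : 5 ≤ Fintype.card V := by omega
  -- The triangles `{v 2, v 3, v 4}` and `{v 0, v 2, v 4}` differ at `v 4`. So exactly one vertex
  -- `w` remains outside, the system having at least six.
  have hc1 : S.conn (v '' Set.Icc 0 4) ≤ 1 := by
    have he : Set.Icc 0 4 = insert 4 (Set.Icc 0 3) := by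
      ext i; simp only [Set.mem_Icc, Set.mem_insert_iff]; omega
    have hlt : S.conn (insert (v 4) (v '' Set.Icc 0 3)) < S.conn (v '' Set.Icc 0 3) :=
      conn_insert_lt_of_tri h3 hV5 (h.2 2 (by omega)).rotate.rotate hT.reverse
        (h.ne (by omega) (by omega) (by omega))
        (h.notMem_image (by omega) (fun j hj => by have := hj.2; omega) (by simp))
        ⟨2, ⟨by omega, by omega⟩, rfl⟩ ⟨3, ⟨by omega, by omega⟩, rfl⟩
        ⟨0, ⟨by omega, by omega⟩, rfl⟩
    have := h.conn_image_Icc_le (a := 0) (b := 3) (by omega) (by omega)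
    rw [he, Set.image_insert_eq]
    omega
  have hcard : (v '' Set.Icc 0 4).ncard = 5 := by
    have := h.ncard_image (s := Finset.Icc 0 4) fun j hj => (Finset.mem_Icc.1 hj).2
    rwa [Finset.coe_Icc, Nat.card_Icc] at this
  have hcompl := ncard_compl_le_one_of_conn_le_one h3 (by omega) hc1
  have hn := ncard_compl_add (v '' Set.Icc 0 4)
  obtain ⟨w, hw⟩ := Set.ncard_eq_one.1 (by omega : (v '' Set.Icc 0 4)ᶜ.ncard = 1)
  have hwv : ∀ i ≤ 4, v i ≠ w := fun i hi hiw => by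
    have : w ∈ (v '' Set.Icc 0 4)ᶜ := by rw [hw]; rfl
    exact this ⟨i, ⟨by omega, hi⟩, hiw⟩
  have hcover : ∀ x, x = w ∨ ∃ i ≤ 4, v i = x := fun x => by
    by_cases hx : x ∈ v '' Set.Icc 0 4
    · obtain ⟨i, hi, hix⟩ := hx
      exact Or.inr ⟨i, hi.2, hix⟩
    · left
      have : x ∈ (v '' Set.Icc 0 4)ᶜ := hx
      rwa [hw] at this
  have key : ∀ a b c, a ≤ 4 → b ≤ 4 → a ≠ b → c ≤ 2 → a ∉ Set.Icc c (c + 2) →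
      b ∉ Set.Icc c (c + 2) → S.Tri (v a) (v b) w := by
    intro a b c ha hb hab hc hac hbc
    refine h.tri_of_compl h3 hV5 (a := c) (b := c + 2) (by omega) (by omega)
      (h.ne ha hb hab) (hwv a ha) (hwv b hb) ?_
    simp only [Set.mem_Icc, not_and, not_le] at hac hbc
    ext x
    constructor
    · intro hx
      rcases hcover x with rfl | ⟨i, hi, rfl⟩
      · simp
      · have hi' : ¬ (c ≤ i ∧ i ≤ c + 2) := fun hi' => hx ⟨i, hi', rfl⟩
        rcases (by omega : i = a ∨ i = b) with rfl | rfl <;> simp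
    · rintro (rfl | rfl | rfl)
      · exact h.notMem_image (by omega) (fun j hj => by have := hj.2; omega) (by simpa using hac)
      · exact h.notMem_image (by omega) (fun j hj => by have := hj.2; omega) (by simpa using hbc)
      · rintro ⟨i, hi, hiw⟩
        exact hwv i (hi.2.trans (by omega)) hiw
  have hu : ∀ i ≤ 4, Function.update v 5 w i = v i := fun i hi =>
    Function.update_of_ne (by omega) _ _
  have hu5 : Function.update v 5 w 5 = w := Function.update_self _ _ _
  -- Appending `w` as `v 5` gives a path of length 4 whose closing triangle `{w, v 0, v 1}` is the
  -- complement of `{v 2, v 3, v 4}`.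
  refine isCyclic (v := Function.update v 5 w) (k := 4) ⟨fun i hi j hj hij => ?_, ?_⟩ h3 hV5
    (by omega) ?_
  · have hi : i ≤ 5 := hi
    have hj : j ≤ 5 := hj
    rcases hi.lt_or_eq with hi | rfl <;> rcases hj.lt_or_eq with hj | rfl
    · rw [hu i (by omega), hu j (by omega)] at hij
      exact h.1 (show i ≤ 4 by omega) (show j ≤ 4 by omega) hij
    · rw [hu i (by omega), hu5] at hij
      exact absurd hij (hwv i (by omega))
    · rw [hu j (by omega), hu5] at hij
      exact absurd hij.symm (hwv j (by omega))
    · rfl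
  · intro i hi
    rcases (by omega : i < 3 ∨ i = 3) with hi | rfl
    · rw [hu i (by omega), hu (i + 1) (by omega), hu (i + 2) (by omega)]
      exact h.2 i hi
    · rw [hu 3 (by omega), hu 4 (by omega), hu5]
      exact key 3 4 0 (by omega) (by omega) (by omega) (by omega) (by simp) (by simp)
  · rw [hu 0 (by omega), hu 1 (by omega), hu5]
    exact (key 0 1 2 (by omega) (by omega) (by omega) (by omega) (by simp) (by simp)).rotate.rotate

end IsPathSeq

/-! ### Extending paths and maximality -/

/-- The sets of three consecutive vertices of the sequence `v 0, …, v (k + 1)`. -/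
def pathEdges (v : ℕ → V) (k : ℕ) : Set (Set V) :=
  {e | ∃ i < k, e = {v i, v (i + 1), v (i + 2)}}

namespace IsPathSeq

variable {v : ℕ → V} {k : ℕ}

theorem mono (h : S.IsPathSeq v k) {l : ℕ} (hl : l ≤ k) : S.IsPathSeq v l :=
  ⟨h.1.mono (Set.Iic_subset_Iic.2 (by omega)), fun i hi => h.2 i (by omega)⟩

theorem reverse (h : S.IsPathSeq v k) : S.IsPathSeq (fun i => v (k + 1 - i)) k := by
  refine ⟨fun i hi j hj hij => ?_, fun i hi => ?_⟩
  · have hi : i ≤ k + 1 := hi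
    have hj : j ≤ k + 1 := hj
    have := h.1 (show k + 1 - i ≤ k + 1 by omega) (show k + 1 - j ≤ k + 1 by omega) hij
    omega
  · have := (h.2 (k - 1 - i) (by omega)).reverse
    rwa [show k - 1 - i + 2 = k + 1 - i by omega, show k - 1 - i + 1 = k + 1 - (i + 1) by omega,
      show k - 1 - i = k + 1 - (i + 2) by omega] at this

/-- The triangle `{v 1, v 2, v 3}` makes `exists_tri_of_essential` applicable at `v 0`. What remains
is to exclude the new vertex from the path, and to exclude a triangle on `v 0, v 2` once `k` exceeds
2. -/
theorem exists_extension [DecidableEq V] (h : S.IsPathSeq v k) (h3 : S.IsKConnected 3)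
    (hV : 5 ≤ Fintype.card V) (hcyc : ¬ S.IsCyclic) (hk : 2 ≤ k) (hv : ¬ S.NonEssential (v 0)) :
    ∃ z ∉ v '' Set.Iic (k + 1), S.Tri z (v 0) (v 1) ∨ k = 2 ∧ S.Tri z (v 0) (v 2) := by
  have hV6 : 6 ≤ Fintype.card V := by
    by_contra hlt
    exact hcyc (isCyclic_of_card_eq_five h3 (by omega))
  obtain ⟨z, hz0, hz1, hz2, hz3, hT⟩ := exists_tri_of_essential h3 hV (h.2 0 (by omega))
    (h.2 1 (by omega)) (h.ne (by omega) (by omega) (by omega)) hv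
  rcases hT with hT | hT
  · refine ⟨z, ?_, Or.inl hT.rotate.rotate⟩
    rintro ⟨j, hj, rfl⟩
    have hj : j ≤ k + 1 := hj
    have h4 : 4 ≤ j := by
      by_contra hlt
      rcases (by omega : j = 0 ∨ j = 1 ∨ j = 2 ∨ j = 3) with rfl | rfl | rfl | rfl
      · exact hz0 rfl
      · exact hz1 rfl
      · exact hz2 rfl
      · exact hz3 rfl
    -- At an inner vertex the triangle would conflict with the two path triangles around it; at the
    -- last vertex the path closes up.
    rcases hj.lt_or_eq with hlt | rfl
    · obtain ⟨i, rfl⟩ : ∃ i, j = i + 2 := ⟨j - 2, by omega⟩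
      exact (h.2 i (by omega)).reverse.false_of_tri h3 hV (h.2 (i + 1) (by omega)).swap
        (h.ne (by omega) (by omega) (by omega)) hT.rotate.rotate
        (h.ne (by omega) (by omega) (by omega)) (h.ne (by omega) (by omega) (by omega))
        (h.ne (by omega) (by omega) (by omega)) (h.ne (by omega) (by omega) (by omega))
        (h.ne (by omega) (by omega) (by omega)) (h.ne (by omega) (by omega) (by omega))
    · exact hcyc (h.isCyclic h3 hV (by omega) hT.rotate.rotate)
  · rcases hk.lt_or_eq with hk3 | rfl
    · exfalso
      by_cases hz4 : z = v 4
      · subst hz4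
        exact hcyc ((h.mono (by omega)).isCyclic_of_tri_zero_two_four h3 hV6 hT)
      · exact (h.2 1 (by omega)).rotate.false_of_tri h3 hV (h.2 2 (by omega))
          (h.ne (by omega) (by omega) (by omega)) hT.swap
          (h.ne (by omega) (by omega) (by omega)) (h.ne (by omega) (by omega) (by omega))
          (h.ne (by omega) (by omega) (by omega)) hz3 hz1 hz4
    · refine ⟨z, ?_, Or.inr ⟨rfl, hT.rotate.rotate⟩⟩
      rintro ⟨j, hj, rfl⟩
      have hj : j ≤ 3 := hj
      rcases (by omega : j = 0 ∨ j = 1 ∨ j = 2 ∨ j = 3) with rfl | rfl | rfl | rfl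
      · exact hz0 rfl
      · exact hz1 rfl
      · exact hz2 rfl
      · exact hz3 rfl

theorem exists_isTightPath (h : S.IsPathSeq v k) (hk : 1 ≤ k) :
    ∃ Q : Hypergraph V, S.triangleHypergraph.IsTightPath Q ∧ Q.edgeSet = pathEdges v k := by
  refine ⟨⟨v '' Set.Iic (k + 1), pathEdges v k, ?_⟩,
    ⟨k, hk, ⟨Set.subset_univ _, ?_⟩, v, h.1, rfl, ?_⟩, rfl⟩
  · rintro _ ⟨i, hi, rfl⟩ w (rfl | rfl | rfl)
    · exact ⟨i, show i ≤ k + 1 by omega, rfl⟩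
    · exact ⟨i + 1, show i + 1 ≤ k + 1 by omega, rfl⟩
    · exact ⟨i + 2, show i + 2 ≤ k + 1 by omega, rfl⟩
  · rintro _ ⟨i, hi, rfl⟩
    obtain ⟨h1, h2, h3, t, ht, hs⟩ := h.2 i hi
    exact ⟨t, ⟨ht, hs ▸ ncard_insert_pair h1 h2 h3⟩, hs.symm⟩
  · ext e
    constructor
    · rintro ⟨i, hi, rfl⟩
      exact ⟨i + 1, by omega, by omega, rfl⟩
    · rintro ⟨i, h1, hi, rfl⟩
      obtain ⟨j, rfl⟩ : ∃ j, i = j + 1 := ⟨i - 1, by omega⟩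
      exact ⟨j, by omega, rfl⟩

/-- Prepending `z` would give a longer tight path, with an edge that is new because it contains `z`.
-/
theorem not_tri_of_isMaximalTightPath (h : S.IsPathSeq v k) {P : Hypergraph V}
    (hP : S.triangleHypergraph.IsMaximalTightPath P) (hPe : P.edgeSet = pathEdges v k) {z : V}
    (hz : z ∉ v '' Set.Iic (k + 1)) : ¬ S.Tri z (v 0) (v 1) := by
  intro hT
  let w : ℕ → V := fun i => Nat.casesOn i z v
  have hw : S.IsPathSeq w (k + 1) := by
    refine ⟨?_, ?_⟩
    · rintro (_ | i) hi (_ | j) hj hij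
      · rfl
      · exact absurd ⟨j, Nat.succ_le_succ_iff.1 hj, hij.symm⟩ hz
      · exact absurd ⟨i, Nat.succ_le_succ_iff.1 hi, hij⟩ hz
      · exact congrArg Nat.succ
          (h.1 (Nat.succ_le_succ_iff.1 hi) (Nat.succ_le_succ_iff.1 hj) hij)
    · rintro (_ | i) hi
      · exact hT
      · exact h.2 i (by omega)
  obtain ⟨Q, hQ, hQe⟩ := hw.exists_isTightPath (by omega)
  refine hP.2 ⟨Q, hQ, ?_⟩
  rw [hPe, hQe, Set.ssubset_iff_of_subset]
  · refine ⟨{z, v 0, v 1}, ⟨0, by omega, rfl⟩, ?_⟩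
    rintro ⟨i, hi, he⟩
    have hzm : z ∈ ({v i, v (i + 1), v (i + 2)} : Set V) := he ▸ Set.mem_insert _ _
    rcases hzm with hz' | hz' | hz'
    · exact hz ⟨i, show i ≤ k + 1 by omega, hz'.symm⟩
    · exact hz ⟨i + 1, show i + 1 ≤ k + 1 by omega, hz'.symm⟩
    · exact hz ⟨i + 2, show i + 2 ≤ k + 1 by omega, hz'.symm⟩
  · rintro _ ⟨i, hi, rfl⟩
    exact ⟨i + 1, by omega, rfl⟩

theorem pathEdges_reverse {α : Type*} (v : ℕ → α) (k : ℕ) :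
    pathEdges (fun i => v (k + 1 - i)) k = pathEdges v k := by
  have rev : ∀ x y z : α, ({x, y, z} : Set α) = {z, y, x} := fun x y z => by
    ext; simp only [Set.mem_insert_iff, Set.mem_singleton_iff]; tauto
  ext e
  constructor
  · rintro ⟨i, hi, rfl⟩
    refine ⟨k - 1 - i, by omega, ?_⟩
    rw [rev, show k - 1 - i + 2 = k + 1 - i by omega,
      show k - 1 - i + 1 = k + 1 - (i + 1) by omega, show k - 1 - i = k + 1 - (i + 2) by omega]
  · rintro ⟨i, hi, rfl⟩
    refine ⟨k - 1 - i, by omega, ?_⟩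
    beta_reduce
    rw [rev, show k + 1 - (k - 1 - i) = i + 2 by omega,
      show k + 1 - (k - 1 - i + 1) = i + 1 by omega, show k + 1 - (k - 1 - i + 2) = i by omega]

theorem isEnd (h : S.IsPathSeq v k) (hk : 1 ≤ k) {P : Hypergraph V} (hv : v 0 ∈ P.vertexSet)
    (hPe : P.edgeSet = pathEdges v k) : P.IsEnd (v 0) := by
  refine ⟨hv, Set.ncard_eq_one.2 ⟨{v 0, v 1, v 2}, ?_⟩⟩
  ext e
  rw [hPe]
  constructor
  · rintro ⟨⟨i, hi, rfl⟩, he⟩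
    have : i = 0 := by
      by_contra hi0
      rcases he with he | he | he
      · exact h.ne (by omega) (by omega) (Ne.symm hi0) he
      · exact h.ne (by omega) (by omega) (by omega) he
      · exact h.ne (by omega) (by omega) (by omega) he
    subst this
    rfl
  · rintro rfl
    exact ⟨⟨0, by omega, rfl⟩, Set.mem_insert _ _⟩

/-- For `k ≥ 2` the first vertex of a maximal tight path of length `k` is non-essential. -/
theorem nonEssential_zero [DecidableEq V] (h : S.IsPathSeq v k) (h3 : S.IsKConnected 3)
    (hV : 5 ≤ Fintype.card V) (hcyc : ¬ S.IsCyclic) (hk : 2 ≤ k) {P : Hypergraph V}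
    (hP : S.triangleHypergraph.IsMaximalTightPath P) (hPe : P.edgeSet = pathEdges v k) :
    S.NonEssential (v 0) := by
  by_contra hv
  obtain ⟨z, hz, hT | ⟨rfl, hT⟩⟩ := h.exists_extension h3 hV hcyc hk hv
  · exact h.not_tri_of_isMaximalTightPath hP hPe hz hT
  -- With `k = 2`, exchanging `v 1` and `v 2` orders the same two edges as a tight path beginning `v
  -- 0, v 2`, which `z` extends.
  · let σ : Equiv.Perm ℕ := Equiv.swap 1 2
    have s0 : σ 0 = 0 := rfl
    have s1 : σ 1 = 2 := rfl
    have s2 : σ 2 = 1 := rfl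
    have s3 : σ 3 = 3 := rfl
    have hσ : ∀ i ≤ 3, σ i ≤ 3 := by decide
    have hw : S.IsPathSeq (v ∘ σ) 2 := by
      refine ⟨fun i hi j hj hij => σ.injective (h.1 (hσ i hi) (hσ j hj) hij), fun i hi => ?_⟩
      rcases (by omega : i = 0 ∨ i = 1) with rfl | rfl
      · exact (h.2 0 (by omega)).reverse.rotate.rotate
      · exact (h.2 1 (by omega)).swap
    refine hw.not_tri_of_isMaximalTightPath hP ?_ (fun ⟨i, hi, hiz⟩ => hz ⟨σ i, hσ i hi, hiz⟩) hT
    rw [hPe]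
    ext e
    have e0 : ({v 0, v 1, v 2} : Set V) = {v 0, v 2, v 1} := by rw [Set.pair_comm]
    have e1 : ({v 1, v 2, v 3} : Set V) = {v 2, v 1, v 3} := Set.insert_comm _ _ _
    constructor <;> rintro ⟨i, hi, rfl⟩ <;>
      rcases (by omega : i = 0 ∨ i = 1) with rfl | rfl
    · exact ⟨0, by omega, e0⟩
    · exact ⟨1, by omega, e1⟩
    · exact ⟨0, by omega, e0.symm⟩
    · exact ⟨1, by omega, e1.symm⟩

end IsPathSeq

/-- A maximal tight path consisting of one triangle meets no other triangle in two vertices. -/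
theorem not_tri_of_edgeSet_eq_singleton {p q r : V} (hT : S.Tri p q r) {P : Hypergraph V}
    (hP : S.triangleHypergraph.IsMaximalTightPath P) (hPe : P.edgeSet = {{p, q, r}}) {z : V}
    (hzp : z ≠ p) (hzq : z ≠ q) (hzr : z ≠ r) : ¬ S.Tri p q z := by
  let v : ℕ → V := fun i => if i = 0 then p else if i = 1 then q else r
  obtain ⟨h1, h2, h3, -⟩ := id hT
  have cases : ∀ i ≤ 2, i = 0 ∨ i = 1 ∨ i = 2 := fun i hi => by omega
  have hv : S.IsPathSeq v 1 := by
    refine ⟨fun i hi j hj hij => ?_, fun i hi => ?_⟩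
    · rcases cases i hi with rfl | rfl | rfl <;> rcases cases j hj with rfl | rfl | rfl <;>
        simp [v, h1, h2, h3, h1.symm, h2.symm, h3.symm] at hij ⊢
    · obtain rfl : i = 0 := by omega
      exact hT
  intro h
  refine hv.not_tri_of_isMaximalTightPath hP (hPe.trans ?_) (z := z) ?_ h.rotate.rotate
  · ext e
    constructor
    · rintro rfl
      exact ⟨0, by omega, rfl⟩
    · rintro ⟨i, hi, rfl⟩
      obtain rfl : i = 0 := by omega
      rfl
  · rintro ⟨i, hi, hiz⟩
    rcases cases i hi with rfl | rfl | rfl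
    · exact hzp hiz.symm
    · exact hzq hiz.symm
    · exact hzr hiz.symm

theorem nonEssential_or_nonEssential [DecidableEq V] (h3 : S.IsKConnected 3)
    (hV : 5 ≤ Fintype.card V) {p q r : V} (hT : S.Tri p q r) {P : Hypergraph V}
    (hP : S.triangleHypergraph.IsMaximalTightPath P) (hPe : P.edgeSet = {{p, q, r}}) :
    S.NonEssential p ∨ S.NonEssential q := by
  by_contra! hne
  obtain ⟨z, hp, hq, hr, h | h | h⟩ := exists_tri_of_two_essential h3 hV hT hne.1 hne.2
  · exact not_tri_of_edgeSet_eq_singleton hT hP hPe hp hq hr h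
  · exact not_tri_of_edgeSet_eq_singleton hT.reverse.rotate.rotate hP
      (hPe.trans (by rw [Set.pair_comm])) hp hr hq h
  · exact not_tri_of_edgeSet_eq_singleton hT.rotate hP
      (hPe.trans (by rw [Set.insert_comm, Set.pair_comm p r])) hq hr hp h

end IsotropicSystem

/-! ### The proposition -/

theorem mainTheorem6 {V : Type*} [Fintype V] [DecidableEq V] (S : IsotropicSystem V)
    (h3 : S.IsKConnected 3) (hV : 5 ≤ Fintype.card V) (hcyc : ¬ S.IsCyclic)
    (P : Hypergraph V) (hP : S.triangleHypergraph.IsMaximalTightPath P) :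
    2 ≤ {v : V | P.IsEnd v ∧ S.NonEssential v}.ncard := by
  obtain ⟨k, hk, ⟨-, hPH⟩, v, hinj, hPv, hPe⟩ := hP.1
  have hPe : P.edgeSet = IsotropicSystem.pathEdges v k := by
    rw [hPe]
    ext e
    constructor
    · rintro ⟨i, h1, hi, rfl⟩
      obtain ⟨j, rfl⟩ : ∃ j, i = j + 1 := ⟨i - 1, by omega⟩
      exact ⟨j, by omega, rfl⟩
    · rintro ⟨i, hi, rfl⟩
      exact ⟨i + 1, by omega, by omega, rfl⟩
  have h : S.IsPathSeq v k := by
    refine ⟨hinj, fun i hi => ?_⟩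
    have ne : ∀ a b, a ≤ k + 1 → b ≤ k + 1 → a ≠ b → v a ≠ v b := fun a b ha hb hab =>
      hinj.ne ha hb hab
    obtain ⟨t, ht, hs⟩ := hPH (hPe ▸ ⟨i, hi, rfl⟩ : ({v i, v (i + 1), v (i + 2)} : Set V) ∈ _)
    exact ⟨ne _ _ (by omega) (by omega) (by omega), ne _ _ (by omega) (by omega) (by omega),
      ne _ _ (by omega) (by omega) (by omega), t, ht.1, hs.symm⟩
  have hmem : ∀ i ≤ k + 1, v i ∈ P.vertexSet := fun i hi => hPv ▸ ⟨i, hi, rfl⟩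
  rcases hk.lt_or_eq with hk2 | rfl
  -- For `k ≥ 2` the two ends are the first and last vertices; the reversed sequence handles the
  -- last.
  · have hPe' := hPe.trans (IsotropicSystem.IsPathSeq.pathEdges_reverse v k).symm
    exact IsotropicSystem.two_le_ncard
      ⟨h.isEnd hk (hmem 0 (by omega)) hPe, h.nonEssential_zero h3 hV hcyc hk2 hP hPe⟩
      ⟨h.reverse.isEnd hk (hmem (k + 1) le_rfl) hPe',
        h.reverse.nonEssential_zero h3 hV hcyc hk2 hP hPe'⟩
      (h.ne (by omega) (by omega) (by omega))
  · have hT := h.2 0 (by omega)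
    have hPe1 : P.edgeSet = {{v 0, v 1, v 2}} := by
      rw [hPe]
      ext e
      constructor
      · rintro ⟨i, hi, rfl⟩
        obtain rfl : i = 0 := by omega
        rfl
      · rintro rfl
        exact ⟨0, by omega, rfl⟩
    have hend : ∀ i ≤ 2, P.IsEnd (v i) := fun i hi => by
      refine ⟨hmem i hi, Set.ncard_eq_one.2 ⟨{v 0, v 1, v 2}, ?_⟩⟩
      rw [hPe1]
      ext e
      constructor
      · exact fun he => he.1
      · rintro rfl
        refine ⟨rfl, ?_⟩
        rcases (by omega : i = 0 ∨ i = 1 ∨ i = 2) with rfl | rfl | rfl <;> simp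
    -- All three vertices are ends, and each pair of them contains a non-essential one, so at most
    -- one is essential.
    have h01 := IsotropicSystem.nonEssential_or_nonEssential h3 hV hT hP hPe1
    have h02 := IsotropicSystem.nonEssential_or_nonEssential h3 hV hT.reverse.rotate.rotate hP
      (hPe1.trans (by rw [Set.pair_comm]))
    have h12 := IsotropicSystem.nonEssential_or_nonEssential h3 hV hT.rotate hP
      (hPe1.trans (by rw [Set.insert_comm, Set.pair_comm (v 0) (v 2)]))
    have key : ∀ i ≤ 2, ∀ j ≤ 2, i ≠ j → S.NonEssential (v i) → S.NonEssential (v j) →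
        2 ≤ {v : V | P.IsEnd v ∧ S.NonEssential v}.ncard := fun i hi j hj hij hi' hj' =>
      IsotropicSystem.two_le_ncard ⟨hend i hi, hi'⟩ ⟨hend j hj, hj'⟩ (h.ne hi hj hij)
    by_cases h0 : S.NonEssential (v 0)
    · rcases h12 with h1 | h2
      · exact key 0 (by omega) 1 (by omega) (by omega) h0 h1
      · exact key 0 (by omega) 2 (by omega) (by omega) h0 h2
    · exact key 1 (by omega) 2 (by omega) (by omega) (h01.resolve_left h0) (h02.resolve_left h0)
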